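/- Let $\Gamma$ be an infinite, locally finite tree with root $\overline 0$, and let $|x-\overline 0|$ be the graph distance. Each vertex $x$ carries a spin $\deg(x)/2$, i.e. the Hilbert space $\mathbb C^{\deg(x)+1}$. For $n\ge 0$ let $T_n$ be the set of vertices with $|x-\overline 0|\le n$ and $\partial T_n$ the set of vertices with $|x-\overline 0|=n+1$. The AKLT Hamiltonian of $T_n$ is $H_n=\sum_{(x,y)}P_{xy}$, summed over the edges with both endpoints in $T_n$, where $P_{xy}$ is the orthogonal projection onto the states in which $x$ and $y$ have the maximal total spin $(\deg(x)+\deg(y))/2$. View the spin at $x$ as the symmetric subspace of $\deg(x)$ spins $\tfrac12$, one for each edge at $x$. Let $\Psi_n:(\mathbb C^2)^{\otimes \partial T_n}\to\bigotimes_{x\in T_n}\mathbb C^{\deg(x)+1}$ be the valence bond solid map: it puts a singlet on each edge inside $T_n$, puts the boundary spins $\tfrac12$ on the edges from $T_n$ to $\partial T_n$, and projects at each vertex onto the symmetric subspace. A boundary condition on $T_n$ is a positive semidefinite $B_n\in M_2(\mathbb C)^{\otimes \partial T_n}$ with $\operatorname{Tr}(\Psi_nB_n\Psi_n^*)\ne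 0$ and $H_n\Psi_nB_n\Psi_n^*=0$ (the last condition says that the state below is a ground state of $H_n$). It defines the finite-volume ground state $$\omega^n_{B_n}(A)=\frac{\operatorname{Tr}(\Psi_nB_n\Psi_n^*\,A)}{\operatorname{Tr}(\Psi_nB_n\Psi_n^*)}$$ on the observables $A$ supported in $T_n$. An infinite-volume ground state is a functional $\omega$ on the local observables (those supported in a finite set of vertices) such that, for some sequence $(B_n)$ of boundary conditions, $\omega(A)=\lim_{n\to\infty}\omega^n_{B_n}(A)$ for every local observable $A$. **Theorem.** Suppose that there are integers $d_i$ such that $\deg(x)=d_i$ for every vertex $x$ with $|x-\overline 0|=i$, and that the limit $$\lim_{n\to\infty}\frac1n\sum_{i=1}^n\ln\frac{d_i-1}{3}$$ exists in $[-\infty,+\infty]$ and is $>0$. Then the AKLT ground state on $\Gamma$ is not unique: there are two different infinite-volume ground states. -/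

import Mathlib

open Filter Topology
open scoped ComplexOrder

noncomputable section

namespace AKLT

/-! ### Spin matrices

The spin-`d/2` space is `ℂ^(d+1)` with orthonormal basis `|0⟩, …, |d⟩`, where `|k⟩` is the
normalised symmetric state of `d` spins 1/2 of which `k` are up; it has `S^z`-eigenvalue
`k - d/2`. -/

/-- `S^z` in the spin-`d/2` representation. -/
def spinZ (d : ℕ) : Matrix (Fin (d + 1)) (Fin (d + 1)) ℂ :=
  Matrix.diagonal fun k => ((k : ℕ) : ℂ) - (d : ℂ) / 2

/-- `S^+` in the spin-`d/2` representation: `S^+ |l⟩ = √((d - l)(l + 1)) |l + 1⟩`. -/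
def spinPlus (d : ℕ) : Matrix (Fin (d + 1)) (Fin (d + 1)) ℂ :=
  Matrix.of fun k l =>
    if (k : ℕ) = (l : ℕ) + 1 then
      ((Real.sqrt (((d : ℝ) - ((l : ℕ) : ℝ)) * (((l : ℕ) : ℝ) + 1)) : ℝ) : ℂ)
    else 0

/-- `S^- = (S^+)^*`. -/
def spinMinus (d : ℕ) : Matrix (Fin (d + 1)) (Fin (d + 1)) ℂ := (spinPlus d).conjTranspose

/-- `S^x = (S^+ + S^-) / 2`. -/
def spinX (d : ℕ) : Matrix (Fin (d + 1)) (Fin (d + 1)) ℂ :=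
  (1 / 2 : ℂ) • (spinPlus d + spinMinus d)

/-- `S^y = (S^+ - S^-) / (2i)`. -/
def spinY (d : ℕ) : Matrix (Fin (d + 1)) (Fin (d + 1)) ℂ :=
  (1 / (2 * Complex.I) : ℂ) • (spinPlus d - spinMinus d)

section Graph

variable {V : Type*} [DecidableEq V] (G : SimpleGraph V) [G.LocallyFinite]

/-! ### Hilbert spaces and observables of finite regions -/

/-- Labels of the product basis of `⨂_{x ∈ S} ℂ^(deg x + 1)`: each vertex `x` carries a spin
`deg x / 2`. -/
abbrev Config (S : Finset V) : Type _ := (x : S) → Fin (G.degree (x : V) + 1)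

/-- The observables supported in the finite region `S`: operators on
`⨂_{x ∈ S} ℂ^(deg x + 1)`, as matrices in the product basis. -/
abbrev Observable (S : Finset V) : Type _ := Matrix (Config G S) (Config G S) ℂ

/-- The one-site operator `M` at `x`, tensored with the identity at all other sites of `S`. -/
def siteOp {S : Finset V} (x : S)
    (M : Matrix (Fin (G.degree (x : V) + 1)) (Fin (G.degree (x : V) + 1)) ℂ) :
    Observable G S :=
  Matrix.of fun k l => if ∀ y : S, y ≠ x → k y = l y then M (k x) (l x) else 0

/-- The restriction of a configuration to a smaller region. -/
def restrict {S T : Finset V} (h : S ⊆ T) (k : Config G T) : Config G S :=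
  fun x => k ⟨(x : V), h x.2⟩

/-- The inclusion `A ↦ A ⊗ 1` of the observables of `S` into those of `T ⊇ S`. -/
def extend {S T : Finset V} (h : S ⊆ T) (A : Observable G S) : Observable G T :=
  Matrix.of fun k l =>
    if ∀ y : T, (y : V) ∉ S → k y = l y then A (restrict G h k) (restrict G h l) else 0

/-! ### The AKLT interaction -/

/-- `(S_x + S_y)^2`, the square of the total spin of the sites `x` and `y`. -/
def totalSpinSq {S : Finset V} (x y : S) : Observable G S :=
  (siteOp G x (spinX (G.degree (x : V))) + siteOp G y (spinX (G.degree (y : V)))) ^ 2 +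
  (siteOp G x (spinY (G.degree (x : V))) + siteOp G y (spinY (G.degree (y : V)))) ^ 2 +
  (siteOp G x (spinZ (G.degree (x : V))) + siteOp G y (spinZ (G.degree (y : V)))) ^ 2

/-- The maximal total spin `J = (deg x + deg y) / 2` of two sites. -/
def maxSpin (x y : V) : ℂ := ((G.degree x : ℂ) + (G.degree y : ℂ)) / 2

/-- The orthogonal projection onto the states in which the sites `x` and `y` have maximal total
spin `J`, that is, onto the eigenspace of `(S_x + S_y)^2` for the eigenvalue `J (J + 1)`. -/
def edgeProjection {S : Finset V} (x y : S) :
    EuclideanSpace ℂ (Config G S) →ₗ[ℂ] EuclideanSpace ℂ (Config G S) :=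
  ((Module.End.eigenspace (Matrix.toEuclideanLin (totalSpinSq G x y))
    (maxSpin G x y * (maxSpin G x y + 1))).starProjection).toLinearMap

/-! ### The finite trees `T_n` -/

variable (o : V)

/-- The vertices of `T_n`: those reachable from the root `o` in at most `n` steps. -/
def ball : ℕ → Finset V
  | 0 => {o}
  | n + 1 => ball n ∪ (ball n).biUnion fun x => G.neighborFinset x

/-- In a connected graph `ball n` is the ball of radius `n` for the graph distance. -/
theorem mem_ball (hG : G.Connected) (n : ℕ) (v : V) : v ∈ ball G o n ↔ G.dist o v ≤ n := by
  induction n generalizing v with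
  | zero => simp [ball, hG.dist_eq_zero_iff, eq_comm]
  | succ n ih =>
    simp only [ball, Finset.mem_union, Finset.mem_biUnion, SimpleGraph.mem_neighborFinset, ih]
    constructor
    · rintro (h | ⟨x, hx, hxv⟩)
      · omega
      · have h1 := hG.dist_triangle (u := o) (v := x) (w := v)
        have h2 : G.dist x v = 1 := SimpleGraph.dist_eq_one_iff_adj.mpr hxv
        omega
    · intro h
      by_cases h' : G.dist o v ≤ n
      · exact Or.inl h'
      · right
        obtain ⟨p, hp⟩ := hG.exists_walk_length_eq_dist v o
        cases p with
        | nil => simp at h'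
        | cons hadj q =>
          rename_i w
          refine ⟨w, ?_, hadj.symm⟩
          have h1 := SimpleGraph.dist_le q
          rw [SimpleGraph.Walk.length_cons, SimpleGraph.dist_comm] at hp
          rw [SimpleGraph.dist_comm]
          omega

/-- `∂T_n`: the vertices of the layer `n + 1`. -/
def boundary (n : ℕ) : Finset V := ball G o (n + 1) \ ball G o n

/-- Membership in `∂T_n` in terms of the graph distance. -/
theorem mem_boundary (hG : G.Connected) (n : ℕ) (v : V) :
    v ∈ boundary G o n ↔ G.dist o v = n + 1 := by
  rw [boundary, Finset.mem_sdiff, mem_ball G o hG, mem_ball G o hG]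
  omega

/-- `y` is a child of `x`. In a tree, each edge joins exactly one vertex to one of its
children. -/
def IsChild (x y : V) : Prop := G.Adj x y ∧ G.dist o y = G.dist o x + 1

open scoped Classical in
/-- The AKLT Hamiltonian of `T_n`: the sum of the projections onto maximal total spin over the
edges with both endpoints in `T_n`. -/
def hamiltonian (n : ℕ) :
    EuclideanSpace ℂ (Config G (ball G o n)) →ₗ[ℂ] EuclideanSpace ℂ (Config G (ball G o n)) :=
  ∑ x : ball G o n, ∑ y : ball G o n,
    if IsChild G o (x : V) (y : V) then edgeProjection G x y else 0

/-! ### Finite-volume states with boundary conditions -/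

/-- Labels of the product basis of `(ℂ²)^{⊗ ∂T_n}`; `true` is spin up. -/
abbrev BoundaryConfig (n : ℕ) : Type _ := boundary G o n → Bool

/-- Boundary conditions on `T_n`: elements of `M_2(ℂ)^{⊗ ∂T_n}`. -/
abbrev BoundaryMatrix (n : ℕ) : Type _ := Matrix (BoundaryConfig G o n) (BoundaryConfig G o n) ℂ

end Graph

/-- The amplitudes of the singlet `|↑↓⟩ - |↓↑⟩`. -/
def singlet : Bool → Bool → ℂ
  | true, false => 1
  | false, true => -1
  | _, _ => 0

/-- The overlap of the basis vector `|k⟩` of the spin-`d/2` space, that is, of the normalised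
symmetric state of `d = |ι|` spins 1/2 with `k` ups, with the product state labelled by `s`. -/
def symAmplitude {ι : Type*} [Fintype ι] (k : ℕ) (s : ι → Bool) : ℂ :=
  if (Finset.univ.filter fun i => s i = true).card = k then
    ((1 / Real.sqrt ((Fintype.card ι).choose k) : ℝ) : ℂ)
  else 0

section Graph

variable {V : Type*} [DecidableEq V] (G : SimpleGraph V) [G.LocallyFinite] (o : V)

open scoped Classical in
/-- The valence bond solid map `(ℂ²)^{⊗ ∂T_n} → ⨂_{x ∈ T_n} ℂ^(deg x + 1)`, as a matrix. Each
vertex `x` of `T_n` is composed of one spin 1/2 for each edge at `x` (`s x y` is the one for the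
edge `xy`). The two spins 1/2 of an edge inside `T_n` form a singlet, the spin 1/2 of an edge
leading to a vertex `v` of `∂T_n` is the boundary spin of `v`, and the spins 1/2 at each vertex are
projected onto their symmetric subspace. -/
def vbs (n : ℕ) : Matrix (Config G (ball G o n)) (BoundaryConfig G o n) ℂ :=
  Matrix.of fun k b =>
    ∑ s : (x : ball G o n) → G.neighborSet (x : V) → Bool,
      (∏ x : ball G o n, symAmplitude (k x : ℕ) (s x)) *
      (∏ x : ball G o n, ∏ y : ball G o n,
        if h : IsChild G o (x : V) (y : V) then
          singlet (s x ⟨(y : V), h.1⟩) (s y ⟨(x : V), h.1.symm⟩)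
        else 1) *
      (if ∀ (x : ball G o n) (v : boundary G o n) (h : G.Adj (x : V) (v : V)),
          s x ⟨(v : V), h⟩ = b v then 1 else 0)

/-- The unnormalised density matrix `Ψ_n B Ψ_n^*` on `T_n` with boundary condition `B`; for
`B = |φ⟩⟨φ|` it is the pure state of the vector `Ψ_n φ`. -/
def density (n : ℕ) (B : BoundaryMatrix G o n) : Observable G (ball G o n) :=
  vbs G o n * B * (vbs G o n).conjTranspose

/-- The expectation `ω^n_B(A)` of an observable `A` supported in `S ⊆ T_n` in the finite-volume
state on `T_n` with boundary condition `B` (set to `0` for the finitely many `n` for which `T_n`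
does not contain `S`). -/
def expectation (n : ℕ) (B : BoundaryMatrix G o n) (S : Finset V) (A : Observable G S) : ℂ :=
  if h : S ⊆ ball G o n then
    (density G o n B * extend G h A).trace / (density G o n B).trace
  else 0

/-- `B` defines a ground state of `T_n`: it is positive, the state is normalisable, and the
Hamiltonian of `T_n` annihilates it. -/
structure IsGroundBoundary (n : ℕ) (B : BoundaryMatrix G o n) : Prop where
  posSemidef : B.PosSemidef
  trace_ne_zero : (density G o n B).trace ≠ 0
  ground : hamiltonian G o n ∘ₗ Matrix.toEuclideanLin (density G o n B) = 0

/-- `ω` is an infinite-volume ground state: the weak limit, on all local observables, of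
finite-volume ground states on `T_n` with some sequence of boundary conditions `B_n`. -/
def IsInfiniteVolumeGroundState (ω : (S : Finset V) → Observable G S → ℂ) : Prop :=
  ∃ B : (n : ℕ) → BoundaryMatrix G o n,
    (∀ n, IsGroundBoundary G o n (B n)) ∧
    ∀ (S : Finset V) (A : Observable G S),
      Tendsto (fun n => expectation G o n (B n) S A) atTop (𝓝 (ω S A))

end Graph

end AKLT

end

noncomputable section

namespace AKLT

/-! The ground states are built from product boundary conditions: each boundary spin carries the
weights `e^θ` (up) and `e^{-θ}` (down), with `θ` depending only on the layer.

Any boundary matrix leads to a state annihilated by the Hamiltonian (`hamiltonian_density_eq_zero`).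
Written in spins 1/2, a vector of maximal total spin on an edge is invariant under exchanging the
two spins on that edge (`apply_upCount_swapLegs`), while the singlet makes the valence bond solid
change sign; hence the two are orthogonal.

Diagonal weights remain diagonal when a leaf of the finite tree is traced out. A vertex whose `q`
lower legs carry the field `θ` puts the field `-F_q(θ)` on the leg of its parent, where `F_q` is
`branchField q` and the minus sign comes from the singlet (`sum_vertex`). If the fields satisfy `θ_i
= -F_{d_i - 1}(θ_{i+1})` for all `i ≥ 1` (`IsConsistent`), then the states on the balls are
restrictions of one another (`expectation_succ`) and the infinite-volume limit is immediate. Since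
`F_q` is odd, `-θ` is consistent along with `θ`. The probability that the root is entirely up is
`e^{dθ_1} / Z(θ_1)` with `d` the degree of the root and `Z` even, so it separates the two states as
soon as `θ_1 ≠ 0`.

It remains to find a nonzero solution. After alternating signs are removed, this is a backward orbit
`τ_i = F_{q_i}(τ_{i+1})` with `q_i = d_{i+1} - 1`. With `Z = partitionSum` one has `tanh F_q = Z' /
((q + 2) Z)`, so the slope of `F_q` at zero is `q / 3`; this is the origin of `(d_i - 1) / 3` in the
hypothesis. Quantitatively, `F_q(θ) ≥ min(qθ, δ) / (3κ)` with `κ` close to 1 (`le_branchField`).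
Starting from the value 1 far away and iterating towards the root, the final value is at least a
constant times a product of `q_i / (3κ)` over an initial segment of layers, and the positive limit
of the averages bounds all such products away from zero. Each coordinate is bounded, so compactness
gives an infinite orbit with `τ_0 > 0` (`exists_branchField_orbit`). -/

/-! ### The scalar recursion -/

/-- `∑_{j ≤ q} e^{(2j-q)θ}`. -/
def partitionSum (q : ℕ) (θ : ℝ) : ℝ :=
  ∑ j ∈ Finset.range (q + 1), Real.exp ((2 * j - q) * θ)

/-- `∑_{j ≤ q} (2j-q) e^{(2j-q)θ}`. -/
def momentSum (q : ℕ) (θ : ℝ) : ℝ :=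
  ∑ j ∈ Finset.range (q + 1), (2 * j - q) * Real.exp ((2 * j - q) * θ)

/-- The weight of an up spin on the parent leg of a vertex whose `q` other legs carry the weights
`e^θ` (up) and `e^{-θ}` (down). -/
def branchWeight (q : ℕ) (θ : ℝ) : ℝ :=
  ∑ j ∈ Finset.range (q + 1), ((j : ℝ) + 1) / (q + 1) * Real.exp ((2 * j - q) * θ)

/-- The field on the parent leg induced by the field `θ` on the `q` other legs. -/
def branchField (q : ℕ) (θ : ℝ) : ℝ :=
  1 / 2 * Real.log (branchWeight q θ / branchWeight q (-θ))

theorem sum_range_flip_exp (q : ℕ) (f : ℝ → ℝ) :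
    ∑ j ∈ Finset.range (q + 1), f (2 * j - q) = ∑ j ∈ Finset.range (q + 1), f (-(2 * j - q)) := by
  rw [← Finset.sum_flip]
  refine Finset.sum_congr rfl fun j hj => ?_
  have : j ≤ q := Nat.lt_succ_iff.mp (Finset.mem_range.mp hj)
  rw [Nat.cast_sub this]
  congr 1
  ring

theorem branchWeight_pos (q : ℕ) (θ : ℝ) : 0 < branchWeight q θ :=
  Finset.sum_pos (fun j _ => by positivity) ⟨0, by simp⟩

theorem branchWeight_neg (q : ℕ) (θ : ℝ) :
    branchWeight q (-θ) =
      ∑ j ∈ Finset.range (q + 1), ((q : ℝ) + 1 - j) / (q + 1) * Real.exp ((2 * j - q) * θ) := by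
  rw [branchWeight, ← Finset.sum_flip]
  refine Finset.sum_congr rfl fun j hj => ?_
  have : j ≤ q := Nat.lt_succ_iff.mp (Finset.mem_range.mp hj)
  rw [Nat.cast_sub this]
  congr 2 <;> ring

/-- Together with `branchWeight_sub` this expresses `tanh (branchField q θ)` as `momentSum q θ / ((q
+ 2) * partitionSum q θ)`, where the slope `q / 3` at zero becomes visible. -/
theorem branchWeight_add (q : ℕ) (θ : ℝ) :
    branchWeight q θ + branchWeight q (-θ) = (q + 2) / (q + 1) * partitionSum q θ := by
  rw [branchWeight_neg, branchWeight, partitionSum, ← Finset.sum_add_distrib, Finset.mul_sum]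
  refine Finset.sum_congr rfl fun j _ => ?_
  ring

theorem branchWeight_sub (q : ℕ) (θ : ℝ) :
    branchWeight q θ - branchWeight q (-θ) = 1 / (q + 1) * momentSum q θ := by
  rw [branchWeight_neg, branchWeight, momentSum, ← Finset.sum_sub_distrib, Finset.mul_sum]
  refine Finset.sum_congr rfl fun j _ => ?_
  ring

theorem partitionSum_pos (q : ℕ) (θ : ℝ) : 0 < partitionSum q θ :=
  Finset.sum_pos (fun j _ => by positivity) ⟨0, by simp⟩

theorem branchField_neg (q : ℕ) (θ : ℝ) : branchField q (-θ) = -branchField q θ := by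
  rw [branchField, branchField, neg_neg, ← inv_div (branchWeight q θ), Real.log_inv]
  ring

theorem continuous_branchField (q : ℕ) : Continuous (branchField q) := by
  have h : Continuous (branchWeight q) := by unfold branchWeight; fun_prop
  refine continuous_const.mul (Continuous.log ?_ fun θ => ?_)
  · exact h.div₀ (h.comp continuous_neg) fun θ => (branchWeight_pos q _).ne'
  · exact (div_pos (branchWeight_pos q _) (branchWeight_pos q _)).ne'

/-- Pairing `j` with `q - j` turns the exponentials into hyperbolic cosines, and `|2j - q| ≤ q`. -/
theorem partitionSum_le (q : ℕ) (θ : ℝ) (hθ : 0 ≤ θ) :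
    partitionSum q θ ≤ (q + 1) * Real.cosh (q * θ) := by
  have h : partitionSum q θ = ∑ j ∈ Finset.range (q + 1), Real.cosh ((2 * j - q) * θ) := by
    have h1 := sum_range_flip_exp q fun u => Real.exp (u * θ)
    have h2 : partitionSum q θ = (partitionSum q θ + partitionSum q θ) / 2 := by ring
    rw [h2]
    nth_rw 2 [partitionSum]
    rw [h1, partitionSum, ← Finset.sum_add_distrib, Finset.sum_div]
    refine Finset.sum_congr rfl fun j _ => ?_
    rw [Real.cosh_eq, neg_mul]
  rw [h]
  refine (Finset.sum_le_card_nsmul _ _ (Real.cosh (q * θ)) fun j hj => ?_).trans_eq (by simp)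
  have hj' : (j : ℝ) ≤ q := by exact_mod_cast Nat.lt_succ_iff.mp (Finset.mem_range.mp hj)
  rw [Real.cosh_le_cosh, abs_mul, abs_mul, abs_of_nonneg hθ]
  refine mul_le_mul_of_nonneg_right ?_ hθ
  rw [abs_of_nonneg (Nat.cast_nonneg q : (0 : ℝ) ≤ q), abs_le]
  constructor <;> linarith [(Nat.cast_nonneg j : (0 : ℝ) ≤ j)]

theorem sum_range_sq (q : ℕ) (n : ℕ) :
    ∑ j ∈ Finset.range n, (2 * (j : ℝ) - q) ^ 2 =
      (n : ℝ) * (2 * (n - 1) * (2 * n - 1) / 3 - 2 * q * (n - 1) + (q : ℝ) ^ 2) := by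
  induction n with
  | zero => simp
  | succ n ih => rw [Finset.sum_range_succ, ih]; push_cast; ring

/-- Pairing `j` with `q - j` gives terms `u * sinh (uθ) ≥ u²θ` with `u = 2j - q`. The constant is
the sum of the `u²`. -/
theorem le_momentSum (q : ℕ) (θ : ℝ) (hθ : 0 ≤ θ) :
    q * (q + 1) * (q + 2) / 3 * θ ≤ momentSum q θ := by
  have h : momentSum q θ =
      ∑ j ∈ Finset.range (q + 1), (2 * (j : ℝ) - q) * Real.sinh ((2 * j - q) * θ) := by
    have h1 := sum_range_flip_exp q fun u => u * Real.exp (u * θ)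
    have h2 : momentSum q θ = (momentSum q θ + momentSum q θ) / 2 := by ring
    rw [h2]
    nth_rw 2 [momentSum]
    rw [h1, momentSum, ← Finset.sum_add_distrib, Finset.sum_div]
    refine Finset.sum_congr rfl fun j _ => ?_
    rw [Real.sinh_eq, neg_mul]
    ring_nf
  have h2 : (q : ℝ) * (q + 1) * (q + 2) / 3 * θ =
      ∑ j ∈ Finset.range (q + 1), (2 * (j : ℝ) - q) ^ 2 * θ := by
    rw [← Finset.sum_mul, sum_range_sq]
    push_cast
    ring
  rw [h, h2]
  refine Finset.sum_le_sum fun j _ => ?_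
  generalize (2 * (j : ℝ) - q) = u
  rw [pow_two, mul_assoc]
  rcases le_total 0 u with hu | hu
  · exact mul_le_mul_of_nonneg_left (Real.self_le_sinh_iff.mpr (mul_nonneg hu hθ)) hu
  · exact mul_le_mul_of_nonpos_left
      (Real.sinh_le_self_iff.mpr (mul_nonpos_of_nonpos_of_nonneg hu hθ)) hu

/-- `momentSum / partitionSum` is the derivative of the convex function `log partitionSum`, hence
monotone. As in Chebyshev's inequality, the difference of the two sides is half of a double sum of
nonnegative terms. -/
theorem momentSum_mul_le (q : ℕ) {η θ : ℝ} (h : η ≤ θ) :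
    momentSum q η * partitionSum q θ ≤ momentSum q θ * partitionSum q η := by
  have key : 0 ≤ ∑ i ∈ Finset.range (q + 1), ∑ j ∈ Finset.range (q + 1),
      ((2 * (i : ℝ) - q) - (2 * j - q)) *
        (Real.exp ((2 * i - q) * θ) * Real.exp ((2 * j - q) * η) -
          Real.exp ((2 * i - q) * η) * Real.exp ((2 * j - q) * θ)) := by
    refine Finset.sum_nonneg fun i _ => Finset.sum_nonneg fun j _ => ?_
    rw [← Real.exp_add, ← Real.exp_add]
    rcases le_total (i : ℝ) j with hij | hij
    · refine mul_nonneg_of_nonpos_of_nonpos (by linarith) (sub_nonpos.mpr (Real.exp_le_exp.mpr ?_))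
      nlinarith
    · refine mul_nonneg (by linarith) (sub_nonneg.mpr (Real.exp_le_exp.mpr ?_))
      nlinarith
  have e : ∑ i ∈ Finset.range (q + 1), ∑ j ∈ Finset.range (q + 1),
      ((2 * (i : ℝ) - q) - (2 * j - q)) *
        (Real.exp ((2 * i - q) * θ) * Real.exp ((2 * j - q) * η) -
          Real.exp ((2 * i - q) * η) * Real.exp ((2 * j - q) * θ)) =
      2 * (momentSum q θ * partitionSum q η - momentSum q η * partitionSum q θ) := by
    have e1 : momentSum q θ * partitionSum q η - momentSum q η * partitionSum q θ =
      partitionSum q η * momentSum q θ - partitionSum q θ * momentSum q η := by ring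
    rw [two_mul]
    nth_rw 2 [e1]
    simp only [momentSum, partitionSum, Finset.sum_mul_sum, ← Finset.sum_sub_distrib,
      ← Finset.sum_add_distrib]
    refine Finset.sum_congr rfl fun i _ => Finset.sum_congr rfl fun j _ => ?_
    ring
  linarith

/-- By monotonicity of `momentSum / partitionSum` the estimate may be made at `η = min θ (δ / q)`,
where the linear approximation loses only the factor `cosh δ`. Passing from `tanh` of the field to
the field costs the factor `1 + δ`. -/
theorem le_branchField {q : ℕ} (hq : 1 ≤ q) {δ : ℝ} (hδ : 0 < δ) {θ : ℝ} (hθ : 0 ≤ θ) :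
    min (q * θ) δ / (3 * (Real.cosh δ * (1 + δ))) ≤ branchField q θ := by
  have hq' : (0 : ℝ) < q := by exact_mod_cast hq
  set η := min θ (δ / q) with hη
  have hη0 : 0 ≤ η := le_min hθ (by positivity)
  have hqη : q * η = min (q * θ) δ := by
    rw [hη, mul_min_of_nonneg _ _ hq'.le, mul_div_cancel₀ _ hq'.ne']
  rw [← hqη]
  have hle : q * η ≤ δ := hqη ▸ min_le_right _ _
  set x := branchWeight q θ
  set y := branchWeight q (-θ)
  have hx : 0 < x := branchWeight_pos _ _
  have hy : 0 < y := branchWeight_pos _ _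
  set c := Real.cosh δ with hc
  have hc0 : 1 ≤ c := Real.one_le_cosh δ
  -- The quotient `(x - y) / (x + y)` is `tanh` of the field.
  have h1 : q * η / (3 * c) * (x + y) ≤ x - y := by
    rw [branchWeight_add, branchWeight_sub]
    have hZ := partitionSum_pos q θ
    have hZη := partitionSum_pos q η
    have h2 : partitionSum q η ≤ (q + 1) * c := by
      refine (partitionSum_le q η hη0).trans ?_
      gcongr
      rw [hc, Real.cosh_le_cosh, abs_of_nonneg (by positivity), abs_of_pos hδ]
      exact hle
    have h3 := le_momentSum q η hη0
    have h4 := momentSum_mul_le q (min_le_left θ (δ / q))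
    rw [← hη] at h4
    have h5 : q * (q + 1) * (q + 2) / 3 * η * partitionSum q θ ≤
        momentSum q θ * ((q + 1) * c) := by
      have hM : 0 ≤ momentSum q θ := (by positivity : (0 : ℝ) ≤ _).trans (le_momentSum q θ hθ)
      calc _ ≤ momentSum q η * partitionSum q θ := by gcongr
        _ ≤ _ := h4
        _ ≤ _ := by gcongr
    rw [← sub_nonneg]
    have : 1 / ((q : ℝ) + 1) * momentSum q θ -
        q * η / (3 * c) * ((q + 2) / (q + 1) * partitionSum q θ) =
        (momentSum q θ * ((q + 1) * c) - q * (q + 1) * (q + 2) / 3 * η * partitionSum q θ) /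
          ((q + 1) ^ 2 * c) := by
      field_simp
    rw [this]
    exact div_nonneg (sub_nonneg.mpr h5) (by positivity)
  have h6 : 1 - y / x ≤ Real.log (x / y) := by
    have := Real.one_sub_inv_le_log_of_pos (div_pos hx hy)
    rwa [inv_div] at this
  have h7 : q * η / (3 * (c * (1 + δ))) ≤ 1 / 2 * (1 - y / x) := by
    set m := q * η / (3 * c) with hm
    have hm0 : 0 ≤ m := by positivity
    have hmδ : m ≤ δ := by
      rw [hm, div_le_iff₀ (by positivity)]
      nlinarith
    have h8 : q * η / (3 * (c * (1 + δ))) = m / (1 + δ) := by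
      rw [hm]; field_simp
    rw [h8, div_le_iff₀ (by positivity)]
    have h9 : 1 / 2 * (1 - y / x) * (1 + δ) = (x - y) * (1 + δ) / (2 * x) := by field_simp
    rw [h9, le_div_iff₀ (by positivity)]
    have hxy : 0 ≤ x - y := le_trans (by positivity) h1
    -- Write `2x = (x + y) + (x - y)`: the first part is controlled by `h1`, the second by `m ≤ δ`.
    nlinarith [mul_le_mul_of_nonneg_left hmδ hxy]
  calc _ ≤ 1 / 2 * (1 - y / x) := h7
    _ ≤ _ := by rw [branchField]; gcongr

/-- Corresponding coefficients of the two weights differ by a factor of at most `q + 1`. The bound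
is uniform in `θ`, which confines all orbits to a compact box. -/
theorem branchField_le (q : ℕ) (θ : ℝ) : branchField q θ ≤ Real.log (q + 1) := by
  have h : branchWeight q θ ≤ (q + 1) * branchWeight q (-θ) := by
    rw [branchWeight_neg, branchWeight, Finset.mul_sum]
    refine Finset.sum_le_sum fun j hj => ?_
    have hj' : (j : ℝ) ≤ q := by exact_mod_cast Nat.lt_succ_iff.mp (Finset.mem_range.mp hj)
    rw [← mul_assoc]
    gcongr
    rw [mul_div_cancel₀ _ (by positivity), div_le_iff₀ (by positivity)]
    nlinarith [(Nat.cast_nonneg j : (0 : ℝ) ≤ j)]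
  have h1 : Real.log (branchWeight q θ / branchWeight q (-θ)) ≤ Real.log (q + 1) := by
    refine Real.log_le_log (div_pos (branchWeight_pos _ _) (branchWeight_pos _ _)) ?_
    rwa [div_le_iff₀ (branchWeight_pos _ _)]
  have h2 : 0 ≤ Real.log ((q : ℝ) + 1) := Real.log_nonneg (by simp)
  rw [branchField]
  linarith

/-- The parent weights are proportional to the leg weights of the induced field. -/
theorem branchWeight_eq (q : ℕ) (θ : ℝ) :
    branchWeight q θ =
      Real.sqrt (branchWeight q θ * branchWeight q (-θ)) * Real.exp (branchField q θ) := by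
  have hx := branchWeight_pos q θ
  have hy := branchWeight_pos q (-θ)
  have : Real.exp (branchField q θ) = Real.sqrt (branchWeight q θ / branchWeight q (-θ)) := by
    rw [branchField, Real.sqrt_eq_rpow, Real.rpow_def_of_pos (div_pos hx hy), mul_comm]
  rw [this, ← Real.sqrt_mul (by positivity)]
  have : branchWeight q θ * branchWeight q (-θ) * (branchWeight q θ / branchWeight q (-θ)) =
      branchWeight q θ ^ 2 := by field_simp
  rw [this, Real.sqrt_sq hx.le]

/-- Backward orbits of the recursion that stay away from zero. -/
theorem exists_branchField_orbit (q : ℕ → ℕ) (hq : ∀ i, 1 ≤ q i) {δ κ p : ℝ} (hδ : 0 < δ)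
    (hκ : Real.cosh δ * (1 + δ) ≤ κ) (hp : 0 < p)
    (hprod : ∀ n, p ≤ ∏ i ∈ Finset.range n, (q i / (3 * κ) : ℝ)) :
    ∃ τ : ℕ → ℝ, 0 < τ 0 ∧ ∀ i, τ i = branchField (q i) (τ (i + 1)) := by
  have hκ1 : 1 ≤ κ := le_trans (by nlinarith [Real.one_le_cosh δ]) hκ
  set ε := min 1 (δ / (3 * κ)) with hε
  have hε0 : 0 < ε := lt_min one_pos (by positivity)
  -- The entry 1 makes room for the starting value of the iteration, the logarithm for the values of
  -- `branchField`.
  let M : ℕ → ℝ := fun i => max 1 (Real.log (q i + 1))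
  let K : ℕ → Set (ℕ → ℝ) := fun n =>
    {τ | p * ε ≤ τ 0 ∧ (∀ i, τ i ∈ Set.Icc 0 (M i)) ∧
      ∀ i < n, τ i = branchField (q i) (τ (i + 1))}
  have hstep : ∀ i (x : ℝ), 0 ≤ x → min (q i / (3 * κ) * x) (δ / (3 * κ)) ≤
      branchField (q i) x := by
    intro i x hx
    refine le_trans ?_ (le_branchField (hq i) hδ hx)
    have h1 : q i / (3 * κ) * x = q i * x / (3 * κ) := by ring
    rw [h1, min_div_div_right (by positivity)]
    have : 0 < Real.cosh δ * (1 + δ) := by positivity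
    gcongr
  have hne : ∀ n, (K n).Nonempty := by
    intro n
    -- Orbits with `n` steps ending at layer `k`, started from the constant 1. Here `m` counts the
    -- layers from `k` outwards up to the nearest saturated step, or up to the start if there is
    -- none.
    have : ∀ n, ∀ k, ∃ τ : ℕ → ℝ, (∀ i, τ i ∈ Set.Icc 0 (M i)) ∧
        (∀ i, k ≤ i → i < k + n → τ i = branchField (q i) (τ (i + 1))) ∧
        ∃ m, ε * ∏ i ∈ Finset.Ico k (k + m), (q i / (3 * κ) : ℝ) ≤ τ k := by
      intro n
      induction n with
      | zero =>
        intro k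
        refine ⟨fun _ => 1, fun i => ⟨zero_le_one, le_max_left _ _⟩, fun i h1 h2 => by omega,
          0, ?_⟩
        simp [hε]
      | succ n ih =>
        intro k
        obtain ⟨τ, h1, h2, m, h3⟩ := ih (k + 1)
        have hb : branchField (q k) (τ (k + 1)) ∈ Set.Icc 0 (M k) := by
          refine ⟨le_trans ?_ (hstep k _ (h1 (k + 1)).1),
            (branchField_le _ _).trans (le_max_right _ _)⟩
          have := (h1 (k + 1)).1
          exact le_min (by positivity) (by positivity)
        refine ⟨Function.update τ k (branchField (q k) (τ (k + 1))), fun i => ?_,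
          fun i hi1 hi2 => ?_, ?_⟩
        · rcases eq_or_ne i k with rfl | hi
          · simpa using hb
          · simpa [hi] using h1 i
        · rcases eq_or_ne i k with rfl | hi
          · simp
          · rw [Function.update_of_ne hi, Function.update_of_ne (by omega)]
            exact h2 i (by omega) (by omega)
        · rw [Function.update_self]
          -- Either the step multiplies the lower bound by `q k / (3κ)`, or it saturates: the new
          -- value is at least `δ / (3κ) ≥ ε` and the product restarts as empty.
          rcases le_total (q k / (3 * κ) * τ (k + 1)) (δ / (3 * κ)) with hc | hc
          · refine ⟨m + 1, ?_⟩
            have h4 := hstep k _ (h1 (k + 1)).1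
            rw [min_eq_left hc] at h4
            refine le_trans ?_ h4
            rw [Finset.prod_eq_prod_Ico_succ_bot (by omega)]
            have : k + (m + 1) = k + 1 + m := by omega
            rw [this, mul_left_comm]
            gcongr
          · refine ⟨0, ?_⟩
            have h4 := hstep k _ (h1 (k + 1)).1
            rw [min_eq_right hc] at h4
            rw [add_zero, Finset.Ico_self, Finset.prod_empty, mul_one]
            exact le_trans (min_le_right _ _) h4
    obtain ⟨τ, h1, h2, m, h3⟩ := this n 0
    refine ⟨τ, le_trans ?_ h3, h1, fun i hi => h2 i (by omega) (by omega)⟩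
    have := hprod m
    rw [Finset.range_eq_Ico] at this
    rw [zero_add, mul_comm]
    gcongr
  have hcl : ∀ n, IsClosed (K n) := by
    intro n
    refine IsClosed.and (isClosed_le continuous_const (continuous_apply 0)) (IsClosed.and ?_ ?_)
    · simp only [Set.ofPred_forall]
      exact isClosed_iInter fun i => isClosed_Icc.preimage (continuous_apply i)
    · simp only [Set.ofPred_forall]
      exact isClosed_iInter fun i => isClosed_iInter fun _ =>
        isClosed_eq (continuous_apply i) ((continuous_branchField _).comp (continuous_apply _))
  have hcpt : IsCompact (K 0) := by
    refine (isCompact_univ_pi fun i => isCompact_Icc (a := (0 : ℝ)) (b := M i)).of_isClosed_subset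
      (hcl 0) ?_
    rintro τ ⟨-, h, -⟩ i -
    exact h i
  -- A common point of the nested compact sets satisfies the recursion at every layer and keeps the
  -- lower bound at layer 0.
  obtain ⟨τ, hτ⟩ := IsCompact.nonempty_iInter_of_sequence_nonempty_isCompact_isClosed K
    (fun n τ h => ⟨h.1, h.2.1, fun i hi => h.2.2 i (by omega)⟩) hne hcpt hcl
  rw [Set.mem_iInter] at hτ
  exact ⟨τ, lt_of_lt_of_le (by positivity) (hτ 0).1, fun i => (hτ (i + 1)).2.2 i (by omega)⟩

/-- A real `l` strictly between 0 and `L` leaves room for the loss `κ = e^l`. Eventually the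
averages exceed `l`, so the products of `q i / (3κ)` exceed 1; the finitely many earlier ones are
positive and only lower the constant `p`. -/
theorem exists_branchField_orbit_of_tendsto (q : ℕ → ℕ) (hq : ∀ i, 1 ≤ q i)
    (L : EReal) (hL : 0 < L)
    (hlim : Tendsto
      (fun n : ℕ =>
        (((1 / (n : ℝ)) * ∑ i ∈ Finset.range n, Real.log (q i / 3) : ℝ) : EReal))
      atTop (𝓝 L)) :
    ∃ τ : ℕ → ℝ, 0 < τ 0 ∧ ∀ i, τ i = branchField (q i) (τ (i + 1)) := by
  obtain ⟨l, hl0, hlL⟩ := EReal.lt_iff_exists_real_btwn.mp hL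
  have hl : 0 < l := by exact_mod_cast hl0
  set κ := Real.exp l with hκ
  have hκ1 : 1 < κ := Real.one_lt_exp_iff.mpr hl
  obtain ⟨δ, hδ, hδκ⟩ : ∃ δ : ℝ, 0 < δ ∧ Real.cosh δ * (1 + δ) ≤ κ := by
    have hcont : Continuous fun δ : ℝ => Real.cosh δ * (1 + δ) := by
      have := Real.continuous_cosh
      fun_prop
    have h1 : ∀ᶠ δ in 𝓝 (0 : ℝ), Real.cosh δ * (1 + δ) < κ :=
      hcont.continuousAt.eventually_lt continuousAt_const (by simpa using hκ1)
    have h2 : ∀ᶠ δ in 𝓝[>] (0 : ℝ), Real.cosh δ * (1 + δ) < κ := nhdsWithin_le_nhds h1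
    obtain ⟨δ, h3, h4⟩ := (h2.and self_mem_nhdsWithin).exists
    exact ⟨δ, h4, h3.le⟩
  have hpos : ∀ i, (0 : ℝ) < q i := fun i => by exact_mod_cast hq i
  have hev : ∀ᶠ n : ℕ in atTop, 1 ≤ ∏ i ∈ Finset.range n, (q i / (3 * κ) : ℝ) := by
    filter_upwards [hlim.eventually (lt_mem_nhds hlL), eventually_gt_atTop 0] with n hn hn0
    have hn' : l < (1 / (n : ℝ)) * ∑ i ∈ Finset.range n, Real.log (q i / 3) := by exact_mod_cast hn
    have hn0' : (0 : ℝ) < n := by exact_mod_cast hn0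
    have e : ∏ i ∈ Finset.range n, (q i / (3 * κ) : ℝ) =
        Real.exp (∑ i ∈ Finset.range n, Real.log (q i / 3) - n * l) := by
      have : ∑ i ∈ Finset.range n, Real.log (q i / 3) - n * l =
          ∑ i ∈ Finset.range n, (Real.log (q i / 3) - l) := by
        rw [Finset.sum_sub_distrib]; simp
      rw [this, Real.exp_sum]
      refine Finset.prod_congr rfl fun i _ => ?_
      have := hpos i
      rw [Real.exp_sub, Real.exp_log (by positivity), div_div]
    rw [e, Real.one_le_exp_iff, sub_nonneg]
    rw [one_div, inv_mul_eq_div, lt_div_iff₀ hn0'] at hn'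
    linarith
  obtain ⟨N, hN⟩ := eventually_atTop.mp hev
  have hP : ∀ n, 0 < ∏ i ∈ Finset.range n, (q i / (3 * κ) : ℝ) := fun n =>
    Finset.prod_pos fun i _ => by have := hpos i; positivity
  obtain ⟨m, -, hm⟩ := Finset.exists_min_image (Finset.range (N + 1))
    (fun n => ∏ i ∈ Finset.range n, (q i / (3 * κ) : ℝ)) ⟨0, by simp⟩
  refine exists_branchField_orbit q hq hδ hδκ
    (p := min 1 (∏ i ∈ Finset.range m, (q i / (3 * κ) : ℝ))) (lt_min one_pos (hP m)) fun n => ?_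
  rcases le_total N n with h | h
  · exact (min_le_left _ _).trans (hN n h)
  · exact (min_le_right _ _).trans (hm n (by simp; omega))

/-! ### Rooted trees -/

section Tree

variable {V : Type*} {G : SimpleGraph V} {o : V}

/-- A shortest walk to a parent, followed by the edge to `v`, is a shortest walk to `v`, hence a
path; and paths in a tree are unique. -/
theorem IsChild.parent_unique (hG : G.IsTree) {x y v : V} (hx : IsChild G o x v)
    (hy : IsChild G o y v) : x = y := by
  have key : ∀ {z : V} (hz : IsChild G o z v), ∃ p : G.Walk o v, p.IsPath ∧ p.penultimate = z := by
    intro z hz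
    obtain ⟨p, hp⟩ := hG.connected.exists_walk_length_eq_dist o z
    refine ⟨p.concat hz.1, SimpleGraph.Walk.isPath_of_length_eq_dist _ ?_, by simp⟩
    rw [SimpleGraph.Walk.length_concat, hp, hz.2]
  obtain ⟨p, hp, rfl⟩ := key hx
  obtain ⟨p', hp', rfl⟩ := key hy
  rw [(hG.existsUnique_path o v).unique hp hp']

theorem exists_isChild (hG : G.Connected) {v : V} {n : ℕ} (hv : G.dist o v = n + 1) :
    ∃ x, IsChild G o x v ∧ G.dist o x = n := by
  obtain ⟨p, hp⟩ := hG.exists_walk_length_eq_dist v o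
  rw [SimpleGraph.dist_comm, hv] at hp
  cases p with
  | nil => simp at hp
  | cons hadj q =>
    rename_i w
    rw [SimpleGraph.Walk.length_cons] at hp
    have h1 : G.dist o w ≤ q.length := by
      rw [SimpleGraph.dist_comm]; exact SimpleGraph.dist_le q
    have h2 := hG.dist_triangle (u := o) (v := w) (w := v)
    have h3 : G.dist w v = 1 := SimpleGraph.dist_eq_one_iff_adj.mpr hadj.symm
    exact ⟨w, ⟨hadj.symm, by omega⟩, by omega⟩

theorem isChild_or_isChild (hG : G.IsTree) {x y : V} (h : G.Adj x y) :
    IsChild G o x y ∨ IsChild G o y x := by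
  rcases hG.dist_eq_dist_add_one_of_adj o h with h1 | h1
  · exact Or.inr ⟨h.symm, h1⟩
  · exact Or.inl ⟨h, h1⟩

variable [G.LocallyFinite]

/-- Balls are finite, so some vertex lies farther out; its chain of ancestors meets every smaller
layer. -/
theorem exists_dist_eq [DecidableEq V] [Infinite V] (hG : G.Connected) (o : V) (n : ℕ) :
    ∃ v, G.dist o v = n := by
  obtain ⟨v, hv⟩ := Infinite.exists_notMem_finset (ball G o n)
  rw [mem_ball G o hG, not_le] at hv
  have : ∀ k v, G.dist o v = n + k → ∃ v, G.dist o v = n := by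
    intro k
    induction k with
    | zero => exact fun v hv => ⟨v, hv⟩
    | succ k ih =>
      intro v hv
      obtain ⟨x, -, hx⟩ := exists_isChild hG hv
      exact ih x hx
  exact this (G.dist o v - n) v (by omega)

theorem exists_dist_eq_degree_pos [DecidableEq V] [Infinite V] (hG : G.Connected) (o : V) (n : ℕ) :
    ∃ x, G.dist o x = n ∧ 1 ≤ G.degree x := by
  obtain ⟨v, hv⟩ := exists_dist_eq hG o (n + 1)
  obtain ⟨x, hx, hxn⟩ := exists_isChild hG hv
  exact ⟨x, hxn, (G.degree_pos_iff_exists_adj x).mpr ⟨v, hx.1⟩⟩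

/-- The parent of a vertex of layer `n + 2` has a child and a parent of its own. Hence `d i - 1 ≥ 1`
off the root, so the logarithms in the hypothesis have positive arguments there. -/
theorem exists_dist_eq_two_le_degree [DecidableEq V] [Infinite V] (hG : G.Connected) (o : V) (n : ℕ) :
    ∃ x, G.dist o x = n + 1 ∧ 2 ≤ G.degree x := by
  obtain ⟨v, hv⟩ := exists_dist_eq hG o (n + 2)
  obtain ⟨x, hx, hxn⟩ := exists_isChild hG hv
  obtain ⟨y, hy, hyn⟩ := exists_isChild hG hxn
  refine ⟨x, hxn, ?_⟩
  rw [← G.card_neighborFinset_eq_degree]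
  refine Finset.one_lt_card.mpr ⟨v, by simpa using hx.1, y, by simpa using hy.1.symm, ?_⟩
  rintro rfl
  omega

variable (G o) in
/-- The children of `x`. -/
def children (x : V) : Finset V := (G.neighborFinset x).filter fun y => G.dist o y = G.dist o x + 1

theorem mem_children {x y : V} : y ∈ children G o x ↔ IsChild G o x y := by
  simp [children, IsChild]

end Tree

/-! ### Sums over the legs of one vertex -/

section Vertex

variable {ι : Type*} [Fintype ι]

/-- The weights `e^θ`, `e^{-θ}` of up and down. -/
def legWeight (θ : ℝ) (b : Bool) : ℂ := (Real.exp (if b then θ else -θ) : ℝ)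

/-- These are the matrix elements of the projection onto the symmetric subspace. It conserves the
number of ups, which is what keeps the reduced weights diagonal. -/
theorem sum_symAmplitude_mul (s s' : ι → Bool) :
    ∑ e : Fin (Fintype.card ι + 1), symAmplitude (e : ℕ) s * symAmplitude (e : ℕ) s' =
      if (Finset.univ.filter fun i => s i = true).card =
        (Finset.univ.filter fun i => s' i = true).card then
        1 / ((Fintype.card ι).choose (Finset.univ.filter fun i => s i = true).card : ℂ) else 0 := by
  have hlt : (Finset.univ.filter fun i => s i = true).card < Fintype.card ι + 1 :=
    Nat.lt_succ_of_le (Finset.card_le_univ _)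
  rw [Finset.sum_eq_single_of_mem (⟨_, hlt⟩ : Fin (Fintype.card ι + 1)) (Finset.mem_univ _)]
  · simp only [symAmplitude, if_true]
    by_cases h : (Finset.univ.filter fun i => s i = true).card =
        (Finset.univ.filter fun i => s' i = true).card
    · rw [if_pos h, if_pos h.symm, ← Complex.ofReal_mul, div_mul_div_comm, one_mul,
        Real.mul_self_sqrt (Nat.cast_nonneg _)]
      push_cast
      rfl
    · rw [if_neg h, if_neg (Ne.symm h), mul_zero]
  · intro e _ he
    rw [symAmplitude, if_neg, zero_mul]
    rintro h
    exact he (Fin.ext h.symm)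

/-- Boolean functions as finite sets. -/
def boolFunEquivFinset [DecidableEq ι] : (ι → Bool) ≃ Finset ι where
  toFun s := Finset.univ.filter fun i => s i = true
  invFun S i := decide (i ∈ S)
  left_inv s := by ext i; simp
  right_inv S := by ext i; simp

theorem sum_card_mul_prod_legWeight [DecidableEq ι] (f : ℕ → ℂ) (θ : ℝ) :
    ∑ s : ι → Bool, f (Finset.univ.filter fun i => s i = true).card * ∏ i, legWeight θ (s i) =
      ∑ j ∈ Finset.range (Fintype.card ι + 1), ((Fintype.card ι).choose j : ℂ) * f j *
        (Real.exp ((2 * j - Fintype.card ι) * θ) : ℝ) := by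
  have h1 : ∀ s : ι → Bool, ∏ i, legWeight θ (s i) =
      (Real.exp ((2 * ((Finset.univ.filter fun i => s i = true).card : ℝ) -
        Fintype.card ι) * θ) : ℝ) := by
    intro s
    simp only [legWeight]
    rw [← Complex.ofReal_prod, ← Real.exp_sum, Finset.sum_ite, Finset.sum_const, Finset.sum_const]
    congr 2
    have h := Finset.card_filter_add_card_filter_not (s := (Finset.univ : Finset ι))
      (fun i => s i = true)
    rw [Finset.card_univ] at h
    rw [← h]
    push_cast
    simp only [nsmul_eq_mul]
    ring
  simp only [h1]
  refine (Fintype.sum_equiv boolFunEquivFinset _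
    (fun S : Finset ι => f S.card * (Real.exp ((2 * (S.card : ℝ) - Fintype.card ι) * θ) : ℝ))
    (fun s => rfl)).trans ?_
  rw [← Finset.powerset_univ,
    Finset.sum_powerset_apply_card
      (fun j => f j * (Real.exp ((2 * (j : ℝ) - Fintype.card ι) * θ) : ℝ)), Finset.card_univ]
  refine Finset.sum_congr rfl fun j _ => ?_
  rw [nsmul_eq_mul, mul_assoc]

theorem singlet_mul_singlet (a a' c : Bool) :
    singlet a c * singlet a' c = if a = a' ∧ c = !a then 1 else 0 := by
  cases a <;> cases a' <;> cases c <;> simp [singlet]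

theorem card_filter_eq_ite_add [DecidableEq ι] (s : ι → Bool) (p : ι) :
    (Finset.univ.filter fun i => s i = true).card =
      (if s p = true then 1 else 0) +
        (Finset.univ.filter fun i : {i // i ≠ p} => s i = true).card := by
  rw [Finset.card_filter, Finset.card_filter, Fintype.sum_eq_add_sum_subtype_ne _ p]

/-- Integrating out a vertex with one leg `p` joined by a singlet to its parent. -/
theorem sum_vertex [DecidableEq ι] (p : ι) {D q : ℕ} (hD : D = Fintype.card ι)
    (hq : Fintype.card ι = q + 1) (θ : ℝ) (a a' : Bool) :
    ∑ e : Fin (D + 1), ∑ s : ι → Bool, ∑ s' : ι → Bool,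
      symAmplitude (e : ℕ) s * symAmplitude (e : ℕ) s' *
        (singlet a (s p) * singlet a' (s' p)) *
        ∏ i ∈ Finset.univ.erase p, (if s i = s' i then legWeight θ (s i) else 0) =
      if a = a' then ((branchWeight q (if a then -θ else θ) : ℝ) : ℂ) else 0 := by
  subst hD
  -- The weights force ket and bra to agree away from `p`; since the numbers of ups agree as well,
  -- they also agree at `p`.
  have hoff : ∀ s s' : ι → Bool, s ≠ s' →
      (∑ e : Fin (Fintype.card ι + 1), symAmplitude (e : ℕ) s * symAmplitude (e : ℕ) s') *
        ∏ i ∈ Finset.univ.erase p, (if s i = s' i then legWeight θ (s i) else 0) = 0 := by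
    intro s s' hs
    by_cases h : ∀ i, i ≠ p → s i = s' i
    · have hp : s p ≠ s' p := fun hp => hs (funext fun i => by
        rcases eq_or_ne i p with rfl | hi
        · exact hp
        · exact h i hi)
      rw [sum_symAmplitude_mul, if_neg, zero_mul]
      rw [card_filter_eq_ite_add s p, card_filter_eq_ite_add s' p]
      have : (Finset.univ.filter fun i : {i // i ≠ p} => s i = true) =
          Finset.univ.filter fun i : {i // i ≠ p} => s' i = true := by
        ext i; simp [h i i.2]
      rw [this]
      cases hc : s p <;> cases hc' : s' p <;> simp_all
    · push Not at h
      obtain ⟨i, hi, hne⟩ := h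
      rw [Finset.prod_eq_zero (i := i) (by simp [hi]) (by simp [hne]), mul_zero]
  have h1 : ∑ e : Fin (Fintype.card ι + 1), ∑ s : ι → Bool, ∑ s' : ι → Bool,
      symAmplitude (e : ℕ) s * symAmplitude (e : ℕ) s' *
        (singlet a (s p) * singlet a' (s' p)) *
        ∏ i ∈ Finset.univ.erase p, (if s i = s' i then legWeight θ (s i) else 0) =
      ∑ s : ι → Bool, (1 / ((Fintype.card ι).choose
        (Finset.univ.filter fun i => s i = true).card : ℂ)) *
          (singlet a (s p) * singlet a' (s p)) * ∏ i ∈ Finset.univ.erase p, legWeight θ (s i) := by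
    rw [Finset.sum_comm]
    refine Finset.sum_congr rfl fun s _ => ?_
    rw [Finset.sum_comm, Finset.sum_eq_single_of_mem s (Finset.mem_univ _)]
    · simp only [if_true]
      rw [← Finset.sum_mul, ← Finset.sum_mul, sum_symAmplitude_mul, if_pos rfl]
    · intro s' _ hs'
      rw [← Finset.sum_mul, ← Finset.sum_mul, mul_right_comm, hoff s s' hs'.symm, zero_mul]
  rw [h1]
  simp only [singlet_mul_singlet]
  by_cases haa : a = a'
  swap
  · simp [haa]
  subst haa
  simp only [true_and, if_true]
  have hcard : Fintype.card {i // i ≠ p} = q := by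
    have := Fintype.card_subtype_compl (fun i => i = p)
    simp only [Fintype.card_subtype_eq, hq, Nat.add_sub_cancel] at this
    convert this using 1
  rw [← (Equiv.funSplitAt p Bool).symm.sum_comp, Fintype.sum_prod_type]
  have hsp : ∀ (c : Bool) (t : {i // i ≠ p} → Bool), (Equiv.funSplitAt p Bool).symm (c, t) p = c := by
    intro c t; simp [Equiv.funSplitAt, Equiv.piSplitAt]
  have hst : ∀ (c : Bool) (t : {i // i ≠ p} → Bool) (i : {i // i ≠ p}),
      (Equiv.funSplitAt p Bool).symm (c, t) i = t i := by
    intro c t i; simp [Equiv.funSplitAt, Equiv.piSplitAt, i.2]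
  have hprod : ∀ (c : Bool) (t : {i // i ≠ p} → Bool),
      ∏ i ∈ Finset.univ.erase p, legWeight θ ((Equiv.funSplitAt p Bool).symm (c, t) i) =
        ∏ i, legWeight θ (t i) := by
    intro c t
    rw [Finset.prod_subtype (p := fun i => i ≠ p) _ (by simp)]
    exact Finset.prod_congr rfl fun i _ => by rw [hst]
  -- The singlet makes the leg `p` opposite to the parent's spin; hence the sign change of the
  -- field.
  rw [Finset.sum_eq_single_of_mem (!a) (Finset.mem_univ _)]
  swap
  · intro c _ hc
    refine Finset.sum_eq_zero fun t _ => ?_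
    rw [hsp, if_neg hc, mul_zero, zero_mul]
  have h2 := sum_card_mul_prod_legWeight (ι := {i // i ≠ p})
    (fun j => 1 / ((q + 1).choose ((if (!a) = true then 1 else 0) + j) : ℂ)) θ
  refine Eq.trans (Finset.sum_congr rfl fun t _ => ?_) (h2.trans ?_)
  · rw [hprod, hsp, if_pos rfl, mul_one, hq, card_filter_eq_ite_add _ p, hsp]
    simp only [hst]
  · rw [hcard]
    -- The binomial ratios for the leg `p` up or down are the coefficients of `branchWeight q θ` and
    -- `branchWeight q (-θ)`.
    have hch : ∀ j ∈ Finset.range (q + 1),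
        ((q.choose j : ℂ) * (1 / ((q + 1).choose (1 + j) : ℂ)) = ((j + 1) / (q + 1) : ℂ)) ∧
        ((q.choose j : ℂ) * (1 / ((q + 1).choose (0 + j) : ℂ)) = ((q + 1 - j) / (q + 1) : ℂ)) := by
      intro j hj
      have hj' : j ≤ q := Nat.lt_succ_iff.mp (Finset.mem_range.mp hj)
      have n1 : ((q + 1).choose (1 + j) : ℂ) ≠ 0 := by
        exact_mod_cast (Nat.choose_pos (by omega)).ne'
      have n2 : ((q + 1).choose (0 + j) : ℂ) ≠ 0 := by
        exact_mod_cast (Nat.choose_pos (by omega)).ne'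
      have n3 : (q + 1 : ℂ) ≠ 0 := by exact_mod_cast Nat.succ_ne_zero q
      constructor
      · rw [mul_one_div, div_eq_div_iff n1 n3, add_comm 1 j, mul_comm (_ : ℂ) (q + 1 : ℂ)]
        have := Nat.add_one_mul_choose_eq q j
        rw [mul_comm ((j : ℂ) + 1)]
        exact_mod_cast this
      · rw [mul_one_div, div_eq_div_iff n2 n3, zero_add]
        have := Nat.choose_mul_succ_eq q j
        have h3 : ((q : ℂ) + 1 - j) = ((q + 1 - j : ℕ) : ℂ) := by
          rw [Nat.cast_sub (by omega)]; push_cast; rfl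
        rw [h3, mul_comm ((q + 1 - j : ℕ) : ℂ)]
        exact_mod_cast this
    cases a
    · simp only [Bool.not_false, if_true, Bool.false_eq_true, if_false]
      rw [branchWeight]
      push_cast
      refine Finset.sum_congr rfl fun j hj => ?_
      rw [(hch j hj).1]
    · simp only [Bool.not_true, if_true, Bool.false_eq_true, if_false]
      rw [branchWeight_neg]
      push_cast
      refine Finset.sum_congr rfl fun j hj => ?_
      rw [(hch j hj).2]

end Vertex

/-! ### Dependent functions on `insert v T` -/

section Glue

variable {V : Type*} [DecidableEq V] {v : V} {T : Finset V} {F : V → Type*}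

/-- Extend a function on `T` by the value `a` at `v`. -/
def glue (a : F v) (f : (x : T) → F x) : (x : ↥(insert v T)) → F x := fun x =>
  if h : (x : V) = v then cast (congrArg F h.symm) a
  else f ⟨x, Finset.mem_of_mem_insert_of_ne x.2 h⟩

theorem glue_self (a : F v) (f : (x : T) → F x) (h : v ∈ insert v T) : glue a f ⟨v, h⟩ = a := by
  simp [glue]

theorem glue_of_mem (hv : v ∉ T) (a : F v) (f : (x : T) → F x) {x : V} (hx : x ∈ T)
    (h : x ∈ insert v T) : glue a f ⟨x, h⟩ = f ⟨x, hx⟩ := by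
  have : x ≠ v := fun e => hv (e ▸ hx)
  simp [glue, this]

/-- `glue` as an equivalence. -/
def glueEquiv (F : V → Type*) (hv : v ∉ T) :
    (((x : T) → F x) × F v) ≃ ((x : ↥(insert v T)) → F x) where
  toFun z := glue z.2 z.1
  invFun g := (fun x => g ⟨x, Finset.mem_insert_of_mem x.2⟩, g ⟨v, Finset.mem_insert_self v T⟩)
  left_inv z := by
    refine Prod.ext (funext fun x => ?_) ?_
    · exact glue_of_mem hv _ _ x.2 _
    · exact glue_self _ _ _
  right_inv g := by
    funext x
    obtain ⟨x, hx⟩ := x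
    rcases Finset.mem_insert.mp hx with rfl | h
    · exact glue_self _ _ _
    · exact glue_of_mem hv _ _ h _

theorem sum_glue [∀ x, Fintype (F x)] (hv : v ∉ T) {M : Type*} [AddCommMonoid M]
    (Φ : ((x : ↥(insert v T)) → F x) → M) :
    ∑ g, Φ g = ∑ f : (x : T) → F x, ∑ a : F v, Φ (glue a f) := by
  classical
  rw [← (glueEquiv F hv).sum_comp, Fintype.sum_prod_type]
  rfl

theorem prod_coe_insert (hv : v ∉ T) {M : Type*} [CommMonoid M] (φ : ↥(insert v T) → M) :
    ∏ x, φ x = φ ⟨v, Finset.mem_insert_self v T⟩ *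
      ∏ x : T, φ ⟨x, Finset.mem_insert_of_mem x.2⟩ := by
  rw [Finset.univ_eq_attach, Finset.attach_insert, Finset.prod_insert, Finset.prod_image]
  · rfl
  · rintro ⟨x, _⟩ _ ⟨y, _⟩ _ h
    simpa using h
  · simp only [Finset.mem_image, not_exists]
    rintro ⟨x, hx⟩ ⟨_, h⟩
    simp only [Subtype.mk.injEq] at h
    exact hv (h ▸ hx)

end Glue

/-! ### The reduced states of finite subtrees -/

section Net

variable {V : Type*} [DecidableEq V] (G : SimpleGraph V) (o : V)

/-- The states of the legs at the vertices of `T`. -/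
abbrev Legs (T : Finset V) : Type _ := (x : T) → G.neighborSet (x : V) → Bool

variable {G}

open scoped Classical in
/-- The state of the leg at `x` on the edge `xy`, with a junk value if there is no such leg. -/
def leg {T : Finset V} (s : Legs G T) (x y : V) : Bool :=
  if h : x ∈ T ∧ G.Adj x y then s ⟨x, h.1⟩ ⟨y, h.2⟩ else false

theorem leg_of_mem {T : Finset V} (s : Legs G T) {x y : V} (hx : x ∈ T) (h : G.Adj x y) :
    leg s x y = s ⟨x, hx⟩ ⟨y, h⟩ := by
  rw [leg, dif_pos ⟨hx, h⟩]

theorem leg_glue_of_mem {T : Finset V} {v : V} (hv : v ∉ T) (a : G.neighborSet v → Bool)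
    (s : Legs G T) {x : V} (y : V) (hx : x ∈ T) :
    leg (glue (F := fun x => G.neighborSet x → Bool) a s : Legs G (insert v T)) x y =
      leg s x y := by
  by_cases h : G.Adj x y
  · rw [leg_of_mem _ (Finset.mem_insert_of_mem hx) h, leg_of_mem _ hx h,
      glue_of_mem (F := fun x => G.neighborSet x → Bool) hv _ _ hx]
  · rw [leg, dif_neg (fun h' => h h'.2), leg, dif_neg (fun h' => h h'.2)]

theorem leg_glue_self {T : Finset V} {v : V} (a : G.neighborSet v → Bool)
    (s : Legs G T) {y : V} (h : G.Adj v y) :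
    leg (glue (F := fun x => G.neighborSet x → Bool) a s : Legs G (insert v T)) v y =
      a ⟨y, h⟩ := by
  rw [leg_of_mem _ (Finset.mem_insert_self _ _) h,
      glue_self (F := fun x => G.neighborSet x → Bool)]

variable (G) [G.LocallyFinite]

/-- The factor of the edge from `x` to its child `y` in the density matrix of `T`, for the leg
states `s` of the ket and `s'` of the bra: a singlet if `y ∈ T`, a diagonal boundary weight
otherwise. -/
def bond (θ : ℕ → ℝ) (T : Finset V) (s s' : V → V → Bool) (x y : V) : ℂ :=
  if y ∈ T then singlet (s x y) (s y x) * singlet (s' x y) (s' y x)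
  else if s x y = s' x y then legWeight (θ (G.dist o y)) (s x y) else 0

/-- The density matrix of the valence bond solid on `T`, with the diagonal weights
`e^θ`, `e^{-θ}` on the legs leaving `T`. -/
def netState (θ : ℕ → ℝ) (T : Finset V) : Observable G T :=
  Matrix.of fun k l => ∑ s : Legs G T, ∑ s' : Legs G T,
    (∏ x : T, symAmplitude (k x : ℕ) (s x) * symAmplitude (l x : ℕ) (s' x)) *
    ∏ x ∈ T, ∏ y ∈ children G o x, bond G o θ T (leg s) (leg s') x y

variable {G o}

/-- As `v` is a child of `p` only, its edge occurs once in the product over all edges and can be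
split off. -/
theorem prod_children_eq (hG : G.IsTree) {T : Finset V} {p v : V} (hp : p ∈ T)
    (hpv : IsChild G o p v) (φ : V → V → ℂ) :
    ∏ x ∈ T, ∏ y ∈ children G o x, φ x y =
      φ p v * ∏ x ∈ T, ∏ y ∈ (children G o x).erase v, φ x y := by
  rw [← Finset.mul_prod_erase T _ hp, ← Finset.mul_prod_erase T _ hp,
    ← Finset.mul_prod_erase _ _ (mem_children.mpr hpv), mul_assoc]
  congr 2
  refine Finset.prod_congr rfl fun x hx => ?_
  rw [Finset.erase_eq_of_notMem]
  intro hv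
  exact (Finset.mem_erase.mp hx).1 ((mem_children.mp hv).parent_unique hG hpv)

theorem children_eq_map (hG : G.IsTree) {p v : V} (hpv : IsChild G o p v) :
    children G o v = ((Finset.univ : Finset (G.neighborSet v)).erase ⟨p, hpv.1.symm⟩).map
      (Function.Embedding.subtype _) := by
  ext y
  simp only [mem_children, Finset.mem_map, Finset.mem_erase, Finset.mem_univ, and_true,
    Function.Embedding.coe_subtype, Subtype.exists, exists_and_right, exists_eq_right, ne_eq,
    SimpleGraph.mem_neighborSet]
  constructor
  · intro h
    refine ⟨h.1, ?_⟩
    intro e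
    obtain rfl : y = p := congrArg Subtype.val e
    have := h.2
    have := hpv.2
    omega
  · rintro ⟨h1, h2⟩
    rcases isChild_or_isChild (o := o) hG h1 with h | h
    · exact h
    · exact absurd (Subtype.ext (h.parent_unique hG hpv)) h2

/-- Tracing out a leaf of `T ∪ {v}`. -/
theorem sum_netState_glue (hG : G.IsTree) {θ : ℕ → ℝ} {T : Finset V} {p v : V} (hv : v ∉ T)
    (hp : p ∈ T) (hpv : IsChild G o p v) (hch : ∀ y, IsChild G o v y → y ∉ T) {q : ℕ}
    (hq : G.degree v = q + 1)
    (hθ : θ (G.dist o v) = -branchField q (θ (G.dist o v + 1))) (k l : Config G T) :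
    ∑ e : Fin (G.degree v + 1),
      netState G o θ (insert v T) (glue (F := fun x => Fin (G.degree x + 1)) e k)
        (glue (F := fun x => Fin (G.degree x + 1)) e l) =
    (Real.sqrt (branchWeight q (θ (G.dist o v + 1)) * branchWeight q (-θ (G.dist o v + 1))) : ℝ) *
      netState G o θ T k l := by
  set θ' := θ (G.dist o v + 1) with hθ'
  set C : ℝ := Real.sqrt (branchWeight q θ' * branchWeight q (-θ')) with hC
  set p' : G.neighborSet v := ⟨p, hpv.1.symm⟩ with hp'
  set R : Legs G T → Legs G T → ℂ := fun f f' =>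
    ∏ x ∈ T, ∏ y ∈ (children G o x).erase v, bond G o θ T (leg f) (leg f') x y with hR
  -- The summand splits into a factor living on `T` without the edge `pv` and a factor containing
  -- `v`, which sees `T` only through the leg of `p`.
  have hterm : ∀ (e : Fin (G.degree v + 1)) (f f' : Legs G T) (a a' : G.neighborSet v → Bool),
      (∏ x : ↥(insert v T),
        symAmplitude (glue (F := fun x => Fin (G.degree x + 1)) e k x : ℕ)
          (glue (F := fun x => G.neighborSet x → Bool) a f x) *
        symAmplitude (glue (F := fun x => Fin (G.degree x + 1)) e l x : ℕ)
          (glue (F := fun x => G.neighborSet x → Bool) a' f' x)) *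
      ∏ x ∈ insert v T, ∏ y ∈ children G o x, bond G o θ (insert v T)
        (leg (glue (F := fun x => G.neighborSet x → Bool) a f : Legs G (insert v T)))
        (leg (glue (F := fun x => G.neighborSet x → Bool) a' f' : Legs G (insert v T))) x y =
      (∏ x : T, symAmplitude (k x : ℕ) (f x) * symAmplitude (l x : ℕ) (f' x)) * R f f' *
        (symAmplitude (e : ℕ) a * symAmplitude (e : ℕ) a' *
          (singlet (leg f p v) (a p') * singlet (leg f' p v) (a' p')) *
          ∏ i ∈ Finset.univ.erase p', (if a i = a' i then legWeight θ' (a i) else 0)) := by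
    intro e f f' a a'
    have h1 : ∏ y ∈ children G o v, bond G o θ (insert v T)
        (leg (glue (F := fun x => G.neighborSet x → Bool) a f : Legs G (insert v T)))
        (leg (glue (F := fun x => G.neighborSet x → Bool) a' f' : Legs G (insert v T))) v y =
        ∏ i ∈ Finset.univ.erase p', (if a i = a' i then legWeight θ' (a i) else 0) := by
      have hmem : ∀ i ∈ (Finset.univ : Finset (G.neighborSet v)).erase p',
          IsChild G o v (i : V) := by
        intro i hi
        rw [← mem_children, children_eq_map hG hpv]
        exact Finset.mem_map_of_mem (Function.Embedding.subtype _) hi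
      rw [children_eq_map hG hpv, Finset.prod_map]
      refine Finset.prod_congr rfl fun i hi => ?_
      have hc := hmem i hi
      have hi1 : (i : V) ∉ insert v T := by
        rw [Finset.mem_insert, not_or]
        exact ⟨hc.1.ne', hch _ hc⟩
      rw [Function.Embedding.coe_subtype, bond, if_neg hi1, leg_glue_self _ _ hc.1,
        leg_glue_self _ _ hc.1]
      simp only [hc.2, hθ']
    have h2 : bond G o θ (insert v T)
        (leg (glue (F := fun x => G.neighborSet x → Bool) a f : Legs G (insert v T)))
        (leg (glue (F := fun x => G.neighborSet x → Bool) a' f' : Legs G (insert v T))) p v =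
        singlet (leg f p v) (a p') * singlet (leg f' p v) (a' p') := by
      rw [bond, if_pos (Finset.mem_insert_self _ _), leg_glue_of_mem hv _ _ _ hp,
        leg_glue_of_mem hv _ _ _ hp, leg_glue_self _ _ hpv.1.symm, leg_glue_self _ _ hpv.1.symm]
    have h3 : ∏ x ∈ T, ∏ y ∈ (children G o x).erase v, bond G o θ (insert v T)
        (leg (glue (F := fun x => G.neighborSet x → Bool) a f : Legs G (insert v T)))
        (leg (glue (F := fun x => G.neighborSet x → Bool) a' f' : Legs G (insert v T))) x y =
        R f f' := by
      refine Finset.prod_congr rfl fun x hx => Finset.prod_congr rfl fun y hy => ?_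
      have hyv : y ≠ v := (Finset.mem_erase.mp hy).1
      rw [bond, bond, leg_glue_of_mem hv _ _ _ hx, leg_glue_of_mem hv _ _ _ hx]
      by_cases hyT : y ∈ T
      · rw [if_pos (Finset.mem_insert_of_mem hyT), if_pos hyT, leg_glue_of_mem hv _ _ _ hyT,
          leg_glue_of_mem hv _ _ _ hyT]
      · rw [if_neg (by simp [hyv, hyT]), if_neg hyT]
    rw [prod_coe_insert hv, Finset.prod_insert hv, prod_children_eq hG hp hpv, h1, h2, h3]
    simp only [glue_self]
    have h4 : ∀ x : T, (glue (F := fun x => Fin (G.degree x + 1)) e k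
        ⟨x, Finset.mem_insert_of_mem x.2⟩) = k x := fun x => glue_of_mem hv _ _ x.2 _
    have h4' : ∀ x : T, (glue (F := fun x => Fin (G.degree x + 1)) e l
        ⟨x, Finset.mem_insert_of_mem x.2⟩) = l x := fun x => glue_of_mem hv _ _ x.2 _
    have h5 : ∀ x : T, (glue (F := fun x => G.neighborSet x → Bool) a f
        ⟨x, Finset.mem_insert_of_mem x.2⟩) = f x := fun x => glue_of_mem hv _ _ x.2 _
    have h5' : ∀ x : T, (glue (F := fun x => G.neighborSet x → Bool) a' f'
        ⟨x, Finset.mem_insert_of_mem x.2⟩) = f' x := fun x => glue_of_mem hv _ _ x.2 _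
    simp only [h4, h4', h5, h5']
    ring
  -- Up to the constant `C`, the summed-out vertex acts on the leg of `p` as a boundary spin with
  -- field `θ (G.dist o v)`; `hθ` is exactly the condition for this.
  have hvert : ∀ c c' : Bool, ∑ e : Fin (G.degree v + 1), ∑ a : G.neighborSet v → Bool,
      ∑ a' : G.neighborSet v → Bool, symAmplitude (e : ℕ) a * symAmplitude (e : ℕ) a' *
          (singlet c (a p') * singlet c' (a' p')) *
          ∏ i ∈ Finset.univ.erase p', (if a i = a' i then legWeight θ' (a i) else 0) =
      C * (if c = c' then legWeight (θ (G.dist o v)) c else 0) := by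
    intro c c'
    have hcard : Fintype.card (G.neighborSet v) = G.degree v := G.card_neighborSet_eq_degree v
    rw [sum_vertex p' hcard.symm (hcard.trans hq) θ' c c']
    split_ifs with h1 h2
    · rw [legWeight, if_pos h2, ← Complex.ofReal_mul, branchWeight_eq, neg_neg, hθ,
        branchField_neg, hC, mul_comm (branchWeight q θ')]
    · rw [legWeight, if_neg h2, ← Complex.ofReal_mul, branchWeight_eq, hθ, neg_neg]
    · rw [mul_zero]
  simp only [netState, Matrix.of_apply]
  have hL : ∀ e : Fin (G.degree v + 1), ∀ Φ : Legs G (insert v T) → Legs G (insert v T) → ℂ,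
      ∑ s, ∑ s', Φ s s' = ∑ f : Legs G T, ∑ f' : Legs G T, ∑ a : G.neighborSet v → Bool,
        ∑ a' : G.neighborSet v → Bool, Φ (glue (F := fun x => G.neighborSet x → Bool) a f)
          (glue (F := fun x => G.neighborSet x → Bool) a' f') := by
    intro e Φ
    rw [sum_glue (F := fun x => G.neighborSet x → Bool) hv]
    refine Finset.sum_congr rfl fun f _ => ?_
    simp only [sum_glue (F := fun x => G.neighborSet x → Bool) hv]
    rw [Finset.sum_comm]
  rw [Finset.sum_congr rfl fun e _ => hL e _]
  simp only [hterm]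
  rw [Finset.sum_comm, Finset.mul_sum]
  refine Finset.sum_congr rfl fun f _ => ?_
  rw [Finset.sum_comm, Finset.mul_sum]
  refine Finset.sum_congr rfl fun f' _ => ?_
  simp only [← Finset.mul_sum]
  rw [hvert, prod_children_eq hG hp hpv, hR]
  simp only [bond, if_neg hv]
  ring

theorem extend_glue {S T : Finset V} {v : V} (h : S ⊆ T) (hv : v ∉ T) (A : Observable G S)
    (e e' : Fin (G.degree v + 1)) (k l : Config G T) :
    extend G (h.trans (Finset.subset_insert v T)) A
      (glue (F := fun x => Fin (G.degree x + 1)) e k)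
      (glue (F := fun x => Fin (G.degree x + 1)) e' l) =
    if e = e' then extend G h A k l else 0 := by
  have hr : ∀ (e : Fin (G.degree v + 1)) (k : Config G T),
      restrict G (h.trans (Finset.subset_insert v T))
        (glue (F := fun x => Fin (G.degree x + 1)) e k) = restrict G h k := by
    intro e k
    funext x
    exact glue_of_mem (F := fun x => Fin (G.degree x + 1)) hv _ _ (h x.2) _
  simp only [extend, Matrix.of_apply, hr]
  by_cases he : e = e'
  · rw [if_pos he]
    refine if_congr ⟨fun H y hy => ?_, fun H y hy => ?_⟩ rfl rfl
    · have := H ⟨y, Finset.mem_insert_of_mem y.2⟩ hy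
      rwa [glue_of_mem (F := fun x => Fin (G.degree x + 1)) hv _ _ y.2,
        glue_of_mem (F := fun x => Fin (G.degree x + 1)) hv _ _ y.2] at this
    · obtain ⟨y, hyT⟩ := y
      rcases Finset.mem_insert.mp hyT with rfl | hyT'
      · rw [glue_self (F := fun x => Fin (G.degree x + 1)),
          glue_self (F := fun x => Fin (G.degree x + 1)), he]
      · rw [glue_of_mem (F := fun x => Fin (G.degree x + 1)) hv _ _ hyT',
          glue_of_mem (F := fun x => Fin (G.degree x + 1)) hv _ _ hyT']
        exact H ⟨y, hyT'⟩ hy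
  · rw [if_neg he, if_neg]
    intro H
    have := H ⟨v, Finset.mem_insert_self v T⟩ (fun hS => hv (h hS))
    rw [glue_self (F := fun x => Fin (G.degree x + 1)),
      glue_self (F := fun x => Fin (G.degree x + 1))] at this
    exact he this

/-- The observable is the identity at `v`, so only the partial trace over `v` enters, and
`sum_netState_glue` evaluates it. -/
theorem trace_netState_insert (hG : G.IsTree) {θ : ℕ → ℝ} {T : Finset V} {p v : V} (hv : v ∉ T)
    (hp : p ∈ T) (hpv : IsChild G o p v) (hch : ∀ y, IsChild G o v y → y ∉ T) {q : ℕ}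
    (hq : G.degree v = q + 1)
    (hθ : θ (G.dist o v) = -branchField q (θ (G.dist o v + 1))) {S : Finset V} (h : S ⊆ T)
    (A : Observable G S) :
    (netState G o θ (insert v T) * extend G (h.trans (Finset.subset_insert v T)) A).trace =
    (Real.sqrt (branchWeight q (θ (G.dist o v + 1)) * branchWeight q (-θ (G.dist o v + 1))) : ℝ) *
      (netState G o θ T * extend G h A).trace := by
  simp only [Matrix.trace, Matrix.diag_apply, Matrix.mul_apply]
  rw [sum_glue (F := fun x => Fin (G.degree x + 1)) hv, Finset.mul_sum]
  refine Finset.sum_congr rfl fun k _ => ?_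
  simp only [sum_glue (F := fun x => Fin (G.degree x + 1)) hv]
  rw [Finset.sum_comm, Finset.mul_sum]
  refine Finset.sum_congr rfl fun l _ => ?_
  simp only [extend_glue h hv, mul_ite, mul_zero, Finset.sum_ite_eq', Finset.mem_univ, if_true]
  rw [← Finset.sum_mul, sum_netState_glue hG hv hp hpv hch hq hθ, mul_assoc]

end Net

/-! ### Product boundary conditions on the balls -/

section

variable {V : Type*} {G : SimpleGraph V} {o : V}

theorem prod_ite_isChild (hG : G.IsTree) {T : Finset V} {p v : V} (hp : p ∈ T)
    [DecidablePred fun x => IsChild G o x v]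
    (hpv : IsChild G o p v) (φ : V → ℂ) :
    ∏ x ∈ T, (if IsChild G o x v then φ x else 1) = φ p := by
  rw [Finset.prod_eq_single_of_mem p hp, if_pos hpv]
  intro x _ hx
  rw [if_neg fun h => hx (h.parent_unique hG hpv)]

end

section Vbs

variable {V : Type*} [DecidableEq V] (G : SimpleGraph V) [G.LocallyFinite] (o : V)

theorem star_symAmplitude {ι : Type*} [Fintype ι] (k : ℕ) (s : ι → Bool) :
    star (symAmplitude k s) = symAmplitude k s := by
  rw [symAmplitude]
  split_ifs <;> simp

theorem star_singlet (a b : Bool) : star (singlet a b) = singlet a b := by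
  cases a <;> cases b <;> simp [singlet]

variable {G o}

theorem filter_isChild_eq {n : ℕ} [DecidablePred fun y => y ∈ ball G o n] (x : V)
    [DecidablePred fun y => IsChild G o x y] :
    (ball G o n).filter (fun y => IsChild G o x y) =
      (children G o x).filter fun y => y ∈ ball G o n := by
  ext y
  simp [mem_children, and_comm]

theorem filter_isChild_boundary_eq (hG : G.Connected) {n : ℕ} {x : V} (hx : x ∈ ball G o n)
    [DecidablePred fun y => IsChild G o x y] :
    (boundary G o n).filter (fun y => IsChild G o x y) =
      (children G o x).filter fun y => y ∉ ball G o n := by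
  ext y
  simp only [Finset.mem_filter, mem_children, mem_boundary G o hG, mem_ball G o hG] at hx ⊢
  constructor
  · rintro ⟨h1, h2⟩
    exact ⟨h2, by omega⟩
  · rintro ⟨h1, h2⟩
    have := h1.2
    exact ⟨by omega, h1⟩

open scoped Classical in
/-- The matrix elements of the valence bond solid map as products over the edges. -/
theorem vbs_apply (hG : G.IsTree) (n : ℕ) (k : Config G (ball G o n))
    (b : BoundaryConfig G o n) :
    vbs G o n k b = ∑ s : Legs G (ball G o n),
      (∏ x : ball G o n, symAmplitude (k x : ℕ) (s x)) *
      (∏ x ∈ ball G o n, ∏ y ∈ children G o x,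
        if y ∈ ball G o n then singlet (leg s x y) (leg s y x) else 1) *
      ∏ v : boundary G o n, ∏ x ∈ ball G o n,
        if IsChild G o x v then (if leg s x v = b v then 1 else 0) else 1 := by
  rw [vbs, Matrix.of_apply]
  refine Finset.sum_congr rfl fun s _ => ?_
  congr 1
  · congr 1
    rw [← Finset.prod_coe_sort (ball G o n)]
    refine Finset.prod_congr rfl fun x _ => ?_
    rw [← Finset.prod_filter, ← filter_isChild_eq, Finset.prod_filter,
      ← Finset.prod_coe_sort (ball G o n)]
    refine Finset.prod_congr rfl fun y _ => ?_
    by_cases h : IsChild G o (x : V) (y : V)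
    · rw [dif_pos h, if_pos h, leg_of_mem _ x.2 h.1, leg_of_mem _ y.2 h.1.symm]
    · rw [dif_neg h, if_neg h]
  -- By distances, an edge leaving the ball leads from a parent to its child.
  · have hadj : ∀ (x : ball G o n) (v : boundary G o n), G.Adj (x : V) (v : V) →
        IsChild G o (x : V) (v : V) := by
      intro x v h
      have h1 := (mem_ball G o hG.connected n x).mp x.2
      have h2 := (mem_boundary G o hG.connected n v).mp v.2
      rcases isChild_or_isChild (o := o) hG h with h3 | h3
      · exact h3
      · have := h3.2
        omega
    by_cases hall : ∀ (x : ball G o n) (v : boundary G o n) (h : G.Adj (x : V) (v : V)),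
        s x ⟨(v : V), h⟩ = b v
    · rw [if_pos hall]
      symm
      refine Finset.prod_eq_one fun v _ => Finset.prod_eq_one fun x hx => ?_
      split_ifs with h1 h2
      · rfl
      · rw [leg_of_mem _ hx h1.1] at h2
        exact absurd (hall ⟨x, hx⟩ v h1.1) h2
      · rfl
    · rw [if_neg hall]
      push Not at hall
      obtain ⟨x, v, h, hne⟩ := hall
      symm
      refine Finset.prod_eq_zero (Finset.mem_univ v) (Finset.prod_eq_zero x.2 ?_)
      rw [if_pos (hadj x v h), leg_of_mem _ x.2 h, if_neg hne]

theorem star_vbs (hG : G.IsTree) (n : ℕ) (k : Config G (ball G o n)) (b : BoundaryConfig G o n) :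
    star (vbs G o n k b) = vbs G o n k b := by
  rw [vbs_apply hG, star_sum]
  refine Finset.sum_congr rfl fun s _ => ?_
  simp only [star_mul', star_prod, star_symAmplitude, apply_ite star, star_one, star_zero,
    star_singlet]

variable (G o)

/-- The product boundary condition with the weights `e^θ`, `e^{-θ}` on each boundary spin. -/
def productBoundary (θ : ℕ → ℝ) (n : ℕ) : BoundaryMatrix G o n :=
  Matrix.diagonal fun b => ∏ v : boundary G o n, legWeight (θ (G.dist o v)) (b v)

variable {G o}

/-- On a ball, the density matrix of a product boundary condition is the tensor network state. -/
theorem density_productBoundary (hG : G.IsTree) (θ : ℕ → ℝ) (n : ℕ) :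
    density G o n (productBoundary G o θ n) = netState G o θ (ball G o n) := by
  classical
  ext k l
  set T := ball G o n with hT
  rw [density, productBoundary, Matrix.mul_apply]
  simp only [Matrix.mul_diagonal, Matrix.conjTranspose_apply, star_vbs hG]
  rw [netState, Matrix.of_apply]
  simp only [vbs_apply hG]
  simp only [Finset.sum_mul, Finset.mul_sum]
  rw [Finset.sum_comm]
  simp only [Finset.sum_comm (s := (Finset.univ : Finset (BoundaryConfig G o n)))]
  refine (Finset.sum_comm).trans ?_
  refine Finset.sum_congr rfl fun s _ => Finset.sum_congr rfl fun s' _ => ?_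
  -- The sum over boundary spins factorises over `∂T_n`. Each boundary vertex has one parent in `T`,
  -- and its spin equals both the ket and the bra leg there, so these coincide.
  have hsum : ∑ b : BoundaryConfig G o n, (∏ v : boundary G o n,
      legWeight (θ (G.dist o v)) (b v)) *
      ((∏ v : boundary G o n, ∏ x ∈ T,
        if IsChild G o x v then (if leg s x v = b v then (1 : ℂ) else 0) else 1) *
      ∏ v : boundary G o n, ∏ x ∈ T,
        if IsChild G o x v then (if leg s' x v = b v then (1 : ℂ) else 0) else 1) =
      ∏ x ∈ T, ∏ y ∈ children G o x, if y ∈ T then 1 else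
        if leg s x y = leg s' x y then legWeight (θ (G.dist o y)) (leg s x y) else 0 := by
    simp only [← Finset.prod_mul_distrib]
    rw [← Fintype.prod_sum (fun (v : boundary G o n) (c : Bool) =>
      legWeight (θ (G.dist o v)) c * ∏ x ∈ T,
        ((if IsChild G o x v then (if leg s x v = c then (1 : ℂ) else 0) else 1) *
          if IsChild G o x v then (if leg s' x v = c then (1 : ℂ) else 0) else 1))]
    have hx : ∀ x ∈ T, (∏ y ∈ children G o x, if y ∈ T then 1 else
        if leg s x y = leg s' x y then legWeight (θ (G.dist o y)) (leg s x y) else 0) =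
        ∏ v : boundary G o n, if IsChild G o x v then
          (if leg s x v = leg s' x v then legWeight (θ (G.dist o v)) (leg s x v) else 0)
          else 1 := by
      intro x hx
      have e : ∀ y : V, (if y ∈ T then 1 else
          if leg s x y = leg s' x y then legWeight (θ (G.dist o y)) (leg s x y) else 0) =
          (if y ∉ T then
          if leg s x y = leg s' x y then legWeight (θ (G.dist o y)) (leg s x y) else 0
          else 1) := by
        intro y; by_cases hy : y ∈ T <;> simp [hy]
      simp only [e]
      rw [← Finset.prod_filter, ← filter_isChild_boundary_eq hG.connected hx, Finset.prod_filter,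
        ← Finset.prod_coe_sort (boundary G o n)]
    rw [Finset.prod_congr rfl hx, Finset.prod_comm]
    refine Finset.prod_congr rfl fun v _ => ?_
    have hv := (mem_boundary G o hG.connected n v).mp v.2
    obtain ⟨p, hpv, hpn⟩ := exists_isChild hG.connected hv
    have hp : p ∈ T := (mem_ball G o hG.connected n p).mpr hpn.le
    rw [prod_ite_isChild hG hp hpv]
    have : ∀ c : Bool, ∏ x ∈ T,
        ((if IsChild G o x v then (if leg s x v = c then (1 : ℂ) else 0) else 1) *
          if IsChild G o x v then (if leg s' x v = c then (1 : ℂ) else 0) else 1) =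
        (if leg s p v = c then (1 : ℂ) else 0) * if leg s' p v = c then (1 : ℂ) else 0 := by
      intro c
      rw [Finset.prod_mul_distrib, prod_ite_isChild hG hp hpv, prod_ite_isChild hG hp hpv]
    simp only [this]
    cases leg s p v <;> cases leg s' p v <;> simp
  have hbond : ∏ x ∈ T, ∏ y ∈ children G o x, bond G o θ T (leg s) (leg s') x y =
      (∏ x ∈ T, ∏ y ∈ children G o x,
        if y ∈ T then singlet (leg s x y) (leg s y x) else 1) *
      (∏ x ∈ T, ∏ y ∈ children G o x,
        if y ∈ T then singlet (leg s' x y) (leg s' y x) else 1) *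
      ∏ x ∈ T, ∏ y ∈ children G o x, if y ∈ T then 1 else
        if leg s x y = leg s' x y then legWeight (θ (G.dist o y)) (leg s x y) else 0 := by
    simp only [← Finset.prod_mul_distrib]
    refine Finset.prod_congr rfl fun x _ => Finset.prod_congr rfl fun y _ => ?_
    rw [bond]
    by_cases hy : y ∈ T <;> simp [hy]
  rw [hbond, ← hsum, Finset.mul_sum, Finset.mul_sum, Finset.prod_mul_distrib]
  refine Finset.sum_congr rfl fun b _ => ?_
  ring

theorem posSemidef_productBoundary (θ : ℕ → ℝ) (n : ℕ) :
    (productBoundary G o θ n).PosSemidef := by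
  refine Matrix.PosSemidef.diagonal fun b => ?_
  simp only [legWeight, ← Complex.ofReal_prod]
  rw [Pi.zero_apply, Complex.zero_le_real]
  exact Finset.prod_nonneg fun v _ => (Real.exp_pos _).le

/-- The local consistency of the fields: the field on the leg above layer `i` is induced by the
fields below it. -/
def IsConsistent (d : ℕ → ℕ) (θ : ℕ → ℝ) : Prop :=
  ∀ i, θ (i + 1) = -branchField (d (i + 1) - 1) (θ (i + 2))

theorem extend_self {S : Finset V} (A : Observable G S) : extend G (Finset.Subset.refl S) A = A := by
  ext k l
  rw [extend, Matrix.of_apply, if_pos fun y hy => absurd y.2 hy]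
  rfl

theorem extend_one {S T : Finset V} (h : S ⊆ T) : extend G h (1 : Observable G S) = 1 := by
  ext k l
  rw [extend, Matrix.of_apply]
  by_cases hkl : k = l
  · subst hkl
    simp
  · rw [Matrix.one_apply_ne hkl]
    split_ifs with h1
    · refine Matrix.one_apply_ne fun h2 => hkl (funext fun x => ?_)
      by_cases hx : (x : V) ∈ S
      · exact congrFun h2 ⟨x, hx⟩
      · exact h1 x hx
    · rfl

/-- The layer `n + 1` is stripped off vertex by vertex. Its vertices are not adjacent to each other,
so each one is a leaf of what remains, in whatever order. What matters is that `c` is the same for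
all observables. -/
theorem exists_trace_netState_ball_succ (hG : G.IsTree) {d : ℕ → ℕ}
    (hd : ∀ x : V, G.degree x = d (G.dist o x)) {θ : ℕ → ℝ} (hθ : IsConsistent d θ) (n : ℕ) :
    ∃ c : ℝ, 0 < c ∧ ∀ (S : Finset V) (A : Observable G S) (h : S ⊆ ball G o n)
      (h' : S ⊆ ball G o (n + 1)),
      (netState G o θ (ball G o (n + 1)) * extend G h' A).trace =
        c * (netState G o θ (ball G o n) * extend G h A).trace := by
  have key : ∀ D : Finset V, D ⊆ boundary G o n → ∃ c : ℝ, 0 < c ∧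
      ∀ T : Finset V, T = D ∪ ball G o n → ∀ (S : Finset V) (A : Observable G S)
        (h : S ⊆ ball G o n) (h' : S ⊆ T),
        (netState G o θ T * extend G h' A).trace =
          c * (netState G o θ (ball G o n) * extend G h A).trace := by
    intro D
    induction D using Finset.induction_on with
    | empty =>
      intro _
      refine ⟨1, one_pos, ?_⟩
      intro T hT S A h h'
      rw [Finset.empty_union] at hT
      subst hT
      simp
    | insert v D hvD ih =>
      intro hD
      obtain ⟨c, hc, H⟩ := ih ((Finset.subset_insert v D).trans hD)
      have hvb := hD (Finset.mem_insert_self v D)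
      have hv := (mem_boundary G o hG.connected n v).mp hvb
      obtain ⟨p, hpv, hpn⟩ := exists_isChild hG.connected hv
      set q := G.degree v - 1 with hq
      have hdeg : G.degree v = q + 1 := by
        have : 0 < G.degree v := (G.degree_pos_iff_exists_adj v).mpr ⟨p, hpv.1.symm⟩
        omega
      have hvT : v ∉ D ∪ ball G o n := by
        rw [Finset.mem_union, not_or]
        exact ⟨hvD, by rw [mem_ball G o hG.connected]; omega⟩
      have hch : ∀ y, IsChild G o v y → y ∉ D ∪ ball G o n := by
        intro y hy hy'
        have h1 := hy.2
        rcases Finset.mem_union.mp hy' with h2 | h2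
        · have := (mem_boundary G o hG.connected n y).mp (hD (Finset.mem_insert_of_mem h2))
          omega
        · have := (mem_ball G o hG.connected n y).mp h2
          omega
      have hp : p ∈ D ∪ ball G o n :=
        Finset.mem_union_right _ ((mem_ball G o hG.connected n p).mpr hpn.le)
      have hθv : θ (G.dist o v) = -branchField q (θ (G.dist o v + 1)) := by
        rw [hq, hd v, hv]
        exact hθ n
      refine ⟨_ * c, mul_pos (Real.sqrt_pos.mpr (mul_pos
        (branchWeight_pos q (θ (G.dist o v + 1))) (branchWeight_pos q (-θ (G.dist o v + 1))))) hc,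
        ?_⟩
      rintro T hT S A h h'
      have hT' : T = insert v (D ∪ ball G o n) := by rw [hT, Finset.insert_union]
      subst hT'
      have hS : S ⊆ D ∪ ball G o n := h.trans Finset.subset_union_right
      rw [trace_netState_insert hG hvT hp hpv hch hdeg hθv hS A, H _ rfl S A h hS]
      push_cast
      ring
  obtain ⟨c, hc, H⟩ := key (boundary G o n) (Finset.Subset.refl _)
  refine ⟨c, hc, fun S A h h' => H _ ?_ S A h h'⟩
  rw [boundary, Finset.sdiff_union_of_subset]
  intro x hx
  rw [mem_ball G o hG.connected] at hx ⊢
  omega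

theorem ball_mono (hG : G.Connected) {m n : ℕ} (h : m ≤ n) : ball G o m ⊆ ball G o n := by
  intro x hx
  rw [mem_ball G o hG] at hx ⊢
  omega

/-- The constant for `A` is also the one for the identity, so it cancels against the normalisation.
-/
theorem expectation_succ (hG : G.IsTree) {d : ℕ → ℕ}
    (hd : ∀ x : V, G.degree x = d (G.dist o x)) {θ : ℕ → ℝ} (hθ : IsConsistent d θ) {n : ℕ}
    {S : Finset V} (h : S ⊆ ball G o n) (A : Observable G S) :
    expectation G o (n + 1) (productBoundary G o θ (n + 1)) S A =
      expectation G o n (productBoundary G o θ n) S A := by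
  obtain ⟨c, hc, H⟩ := exists_trace_netState_ball_succ hG hd hθ n
  have h' := h.trans (ball_mono hG.connected n.le_succ)
  rw [expectation, expectation, dif_pos h, dif_pos h', density_productBoundary hG,
    density_productBoundary hG, H S A h h']
  have h1 := H S 1 h h'
  rw [extend_one, extend_one, mul_one, mul_one] at h1
  rw [h1, mul_div_mul_left]
  exact_mod_cast hc.ne'

theorem ball_zero : ball G o 0 = {o} := rfl

theorem root_mem_ball_zero : o ∈ ball G o 0 := by rw [ball_zero, Finset.mem_singleton]

/-- For the root alone there are no singlets, and the number of leg states with `k` ups cancels the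
normalisation of `|k⟩`. -/
theorem netState_root_diag (θ : ℕ → ℝ) (k : Config G (ball G o 0)) :
    netState G o θ (ball G o 0) k k =
      (Real.exp ((2 * (k ⟨o, root_mem_ball_zero⟩ : ℕ) - G.degree o) * θ 1) : ℝ) := by
  have ho : o ∈ ball G o 0 := root_mem_ball_zero
  let : Unique (ball G o 0) := ⟨⟨⟨o, ho⟩⟩, fun x => Subtype.ext (Finset.mem_singleton.mp x.2)⟩
  have hchild : ∀ y, IsChild G o o y ↔ G.Adj o y := by
    intro y
    refine ⟨fun h => h.1, fun h => ⟨h, ?_⟩⟩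
    rw [SimpleGraph.dist_self, SimpleGraph.dist_eq_one_iff_adj.mpr h]
  have hbond : ∀ s s' : Legs G (ball G o 0),
      ∏ x ∈ ball G o 0, ∏ y ∈ children G o x, bond G o θ (ball G o 0) (leg s) (leg s') x y =
      ∏ y : G.neighborSet o, if s ⟨o, ho⟩ y = s' ⟨o, ho⟩ y then legWeight (θ 1) (s ⟨o, ho⟩ y)
        else 0 := by
    intro s s'
    rw [Finset.prod_eq_single_of_mem o ho fun x hx hne =>
      absurd (Finset.mem_singleton.mp hx) hne,
      Finset.prod_subtype (p := fun y => y ∈ G.neighborSet o) _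
      (fun y => by rw [mem_children, hchild, SimpleGraph.mem_neighborSet])]
    refine Finset.prod_congr rfl fun y _ => ?_
    have hy : G.Adj o y := y.2
    rw [bond, if_neg (by rw [ball_zero, Finset.mem_singleton]; exact hy.ne'), leg_of_mem _ ho hy,
      leg_of_mem _ ho hy, SimpleGraph.dist_eq_one_iff_adj.mpr hy]
  rw [netState, Matrix.of_apply]
  simp only [hbond, Fintype.prod_unique]
  refine (Fintype.sum_equiv
    (Equiv.piUnique fun x : ball G o 0 => G.neighborSet (x : V) → Bool) _
    (fun t : G.neighborSet o → Bool => ∑ t' : G.neighborSet o → Bool,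
      symAmplitude (k ⟨o, ho⟩ : ℕ) t * symAmplitude (k ⟨o, ho⟩ : ℕ) t' *
        ∏ y, if t y = t' y then legWeight (θ 1) (t y) else 0)
    (fun s => Fintype.sum_equiv
      (Equiv.piUnique fun x : ball G o 0 => G.neighborSet (x : V) → Bool) _ _ fun s' => rfl)).trans ?_
  set m : ℕ := (k ⟨o, ho⟩ : ℕ) with hm
  have hmle : m ≤ G.degree o := Nat.lt_succ_iff.mp (k ⟨o, ho⟩).2
  have hcard : Fintype.card (G.neighborSet o) = G.degree o := G.card_neighborSet_eq_degree o
  have h1 : ∀ t : G.neighborSet o → Bool, ∑ t' : G.neighborSet o → Bool,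
      symAmplitude m t * symAmplitude m t' *
        ∏ y, (if t y = t' y then legWeight (θ 1) (t y) else 0) =
      (fun j : ℕ => if j = m then 1 / ((G.degree o).choose m : ℂ) else 0)
        (Finset.univ.filter fun i => t i = true).card * ∏ y, legWeight (θ 1) (t y) := by
    intro t
    rw [Finset.sum_eq_single_of_mem t (Finset.mem_univ _)]
    · simp only [if_true, symAmplitude, hcard]
      split_ifs
      · rw [← Complex.ofReal_mul, div_mul_div_comm, one_mul, Real.mul_self_sqrt (Nat.cast_nonneg _)]
        push_cast
        rfl
      · rw [mul_zero]
    · intro t' _ ht'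
      obtain ⟨y, hy⟩ := Function.ne_iff.mp ht'
      rw [Finset.prod_eq_zero (Finset.mem_univ y) (if_neg (Ne.symm hy)), mul_zero]
  refine (Finset.sum_congr rfl fun t _ => h1 t).trans ?_
  refine (sum_card_mul_prod_legWeight
    (fun j : ℕ => if j = m then 1 / ((G.degree o).choose m : ℂ) else 0) (θ 1)).trans ?_
  have hcard' : Fintype.card (G.neighborSet ((default : ball G o 0) : V)) = G.degree o := hcard
  rw [hcard',
    Finset.sum_eq_single_of_mem m (by simpa using Nat.lt_succ_of_le hmle)]
  · rw [if_pos rfl, mul_one_div, div_self, one_mul]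
    exact_mod_cast (Nat.choose_pos hmle).ne'
  · intro j _ hj
    rw [if_neg hj, mul_zero, zero_mul]

/-- The trace is a sum of exponentials at the root, and each further layer multiplies it by a
positive constant. -/
theorem trace_density_ne_zero (hG : G.IsTree) {d : ℕ → ℕ}
    (hd : ∀ x : V, G.degree x = d (G.dist o x)) {θ : ℕ → ℝ} (hθ : IsConsistent d θ) (n : ℕ) :
    (density G o n (productBoundary G o θ n)).trace ≠ 0 := by
  rw [density_productBoundary hG]
  induction n with
  | zero =>
    rw [Matrix.trace]
    simp only [Matrix.diag_apply, netState_root_diag, ← Complex.ofReal_sum]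
    rw [Complex.ofReal_ne_zero]
    refine (Finset.sum_pos (fun k _ => Real.exp_pos _) ?_).ne'
    exact ⟨fun _ => 0, Finset.mem_univ _⟩
  | succ n ih =>
    obtain ⟨c, hc, H⟩ := exists_trace_netState_ball_succ hG hd hθ n
    have h1 := H (ball G o n) 1 (Finset.Subset.refl _) (ball_mono hG.connected n.le_succ)
    rw [extend_one, extend_one, mul_one, mul_one] at h1
    rw [h1]
    exact mul_ne_zero (by exact_mod_cast hc.ne') ih

end Vbs

/-! ### Ladder operators in the unnormalised basis -/

/-- The norm `√(d choose i)` of the sum of the product states with `i` ups. -/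
def symNorm (d i : ℕ) : ℂ := (Real.sqrt (d.choose i) : ℝ)

theorem symNorm_ne_zero {d i : ℕ} (h : i ≤ d) : symNorm d i ≠ 0 := by
  rw [symNorm, Complex.ofReal_ne_zero, Real.sqrt_ne_zero']
  exact_mod_cast Nat.choose_pos h

theorem sqrt_mul_symNorm {d i : ℕ} (h : i < d) :
    (Real.sqrt (((d : ℝ) - i) * (i + 1)) : ℂ) * symNorm d i = (i + 1) * symNorm d (i + 1) := by
  rw [symNorm, symNorm, ← Complex.ofReal_mul]
  have h1 : ((d : ℝ) - i) = ((d - i : ℕ) : ℝ) := by rw [Nat.cast_sub h.le]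
  have h2 : ((d.choose (i + 1) : ℝ)) * (i + 1) = d.choose i * (d - i : ℕ) := by
    exact_mod_cast Nat.choose_succ_right_eq d i
  rw [h1, ← Real.sqrt_mul (by positivity)]
  have h3 : ((d - i : ℕ) : ℝ) * (i + 1) * d.choose i = (i + 1) ^ 2 * d.choose (i + 1) := by
    linear_combination (-((i : ℝ) + 1)) * h2
  rw [h3, Real.sqrt_mul (by positivity), Real.sqrt_sq (by positivity)]
  push_cast
  ring

theorem sqrt_mul_symNorm_succ {d i : ℕ} (h : i < d) :
    (Real.sqrt (((d : ℝ) - i) * (i + 1)) : ℂ) * symNorm d (i + 1) = (d - i) * symNorm d i := by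
  have h0 : ((i : ℂ) + 1) ≠ 0 := by exact_mod_cast i.succ_ne_zero
  refine mul_left_cancel₀ h0 ?_
  rw [mul_left_comm, ← sqrt_mul_symNorm h, ← mul_assoc, ← Complex.ofReal_mul,
    Real.mul_self_sqrt (mul_nonneg (sub_nonneg.mpr (by exact_mod_cast h.le)) (by positivity))]
  push_cast
  ring

/-- On amplitudes relative to the unnormalised basis the square roots disappear. The junk value `g
(0 - 1)` has coefficient zero, as does `g (d + 1)` in `sum_spinMinus`. -/
theorem sum_spinPlus (d : ℕ) (i : Fin (d + 1)) (g : ℕ → ℂ) :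
    ∑ a : Fin (d + 1), spinPlus d i a * (symNorm d a * g a) = i * symNorm d i * g (i - 1) := by
  obtain ⟨i, hi⟩ := i
  rcases i with _ | i
  · simp [spinPlus]
  · have hid : i < d := by omega
    rw [Finset.sum_eq_single_of_mem (⟨i, by omega⟩ : Fin (d + 1)) (Finset.mem_univ _)]
    · simp only [spinPlus, Matrix.of_apply, if_true, Nat.add_sub_cancel]
      rw [← mul_assoc, sqrt_mul_symNorm hid]
      push_cast
      rfl
    · intro a _ ha
      rw [spinPlus, Matrix.of_apply, if_neg, zero_mul]
      intro h
      exact ha (Fin.ext (by simpa using h.symm))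

theorem sum_spinMinus (d : ℕ) (i : Fin (d + 1)) (g : ℕ → ℂ) :
    ∑ a : Fin (d + 1), spinMinus d i a * (symNorm d a * g a) =
      (d - i) * symNorm d i * g (i + 1) := by
  obtain ⟨i, hi⟩ := i
  rcases (Nat.lt_succ_iff.mp hi).eq_or_lt with rfl | hid
  · rw [sub_self, zero_mul, zero_mul]
    refine Finset.sum_eq_zero fun a _ => ?_
    rw [spinMinus, Matrix.conjTranspose_apply, spinPlus, Matrix.of_apply, if_neg, star_zero,
      zero_mul]
    have := a.2
    simp only
    omega
  · rw [Finset.sum_eq_single_of_mem (⟨i + 1, by omega⟩ : Fin (d + 1)) (Finset.mem_univ _)]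
    · simp only [spinMinus, Matrix.conjTranspose_apply, spinPlus, Matrix.of_apply, if_true]
      rw [Complex.star_def, Complex.conj_ofReal, ← mul_assoc, sqrt_mul_symNorm_succ hid]
    · intro a _ ha
      rw [spinMinus, Matrix.conjTranspose_apply, spinPlus, Matrix.of_apply, if_neg, star_zero,
        zero_mul]
      intro h
      exact ha (Fin.ext h)

theorem spinPlus_mul_spinMinus (d : ℕ) :
    spinPlus d * spinMinus d =
      Matrix.diagonal fun i : Fin (d + 1) => ((i : ℕ) : ℂ) * ((d : ℂ) - (i : ℕ) + 1) := by
  ext i j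
  have hj : symNorm d j ≠ 0 := symNorm_ne_zero (Nat.lt_succ_iff.mp j.2)
  -- The matrix entry results from applying `sum_spinMinus` to a delta function at `j`.
  have h1 : ∀ a : Fin (d + 1), spinMinus d a j =
      (symNorm d a * ((d - (a : ℕ)) * (if (a : ℕ) + 1 = j then 1 else 0))) / symNorm d j := by
    intro a
    have := sum_spinMinus d a fun b => if b = j then 1 else 0
    rw [Finset.sum_eq_single_of_mem j (Finset.mem_univ _)] at this
    · rw [eq_div_iff hj]
      simpa [mul_comm, mul_left_comm, mul_assoc] using this
    · intro b _ hb
      rw [if_neg (fun h => hb (Fin.ext h))]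
      simp
  rw [Matrix.mul_apply]
  simp only [h1, mul_div_assoc']
  rw [← Finset.sum_div, sum_spinPlus d i fun a => (d - (a : ℕ)) * (if a + 1 = j then 1 else 0)]
  rcases Nat.eq_zero_or_pos (i : ℕ) with hi | hi
  · by_cases hij : i = j
    · subst hij
      simp [hi]
    · simp [hi, Matrix.diagonal_apply_ne _ hij]
  · have e : (i : ℕ) - 1 + 1 = i := Nat.sub_add_cancel hi
    by_cases hij : i = j
    · subst hij
      rw [e, if_pos rfl, mul_one, Matrix.diagonal_apply_eq, Nat.cast_sub hi]
      field_simp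
      push_cast
      ring
    · rw [e, if_neg (fun h => hij (Fin.ext h)), Matrix.diagonal_apply_ne _ hij]
      simp

theorem spinMinus_mul_spinPlus (d : ℕ) :
    spinMinus d * spinPlus d =
      Matrix.diagonal fun i : Fin (d + 1) => ((d : ℂ) - (i : ℕ)) * ((i : ℕ) + 1) := by
  ext i j
  have hj : symNorm d j ≠ 0 := symNorm_ne_zero (Nat.lt_succ_iff.mp j.2)
  have h1 : ∀ a : Fin (d + 1), spinPlus d a j =
      (symNorm d a * ((a : ℕ) * (if (a : ℕ) - 1 = j then 1 else 0))) / symNorm d j := by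
    intro a
    have := sum_spinPlus d a fun b => if b = j then 1 else 0
    rw [Finset.sum_eq_single_of_mem j (Finset.mem_univ _)] at this
    · rw [eq_div_iff hj]
      simpa [mul_comm, mul_left_comm, mul_assoc] using this
    · intro b _ hb
      rw [if_neg (fun h => hb (Fin.ext h))]
      simp
  rw [Matrix.mul_apply]
  simp only [h1, mul_div_assoc']
  rw [← Finset.sum_div, sum_spinMinus d i fun a => (a : ℕ) * (if a - 1 = j then 1 else 0)]
  by_cases hij : i = j
  · subst hij
    rw [Nat.add_sub_cancel, if_pos rfl, mul_one, Matrix.diagonal_apply_eq]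
    field_simp
    push_cast
    ring
  · rw [Nat.add_sub_cancel, if_neg (fun h => hij (Fin.ext h)), Matrix.diagonal_apply_ne _ hij]
    simp

/-- The Casimir element of the spin-`d/2` representation. -/
theorem spin_casimir (d : ℕ) :
    (1 / 2 : ℂ) • (spinPlus d * spinMinus d + spinMinus d * spinPlus d) + spinZ d * spinZ d =
      Matrix.diagonal fun _ => (d : ℂ) / 2 * (d / 2 + 1) := by
  rw [spinPlus_mul_spinMinus, spinMinus_mul_spinPlus, spinZ, Matrix.diagonal_mul_diagonal,
    Matrix.diagonal_add, ← Matrix.diagonal_smul, Matrix.diagonal_add]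
  congr 1
  ext i
  simp only [Pi.smul_apply, smul_eq_mul]
  ring

/-- The equation satisfied along a line of constant magnetisation by the vectors of maximal total
spin has only constant solutions. -/
theorem eq_of_line_equation {a b : ℕ} {f : ℕ → ℕ → ℂ}
    (h : ∀ i ≤ a, ∀ j ≤ b, ((i : ℂ) * (b - j) + j * (a - i)) * f i j =
      i * (b - j) * f (i - 1) (j + 1) + j * (a - i) * f (i + 1) (j - 1)) :
    ∀ i < a, ∀ j < b, f (i + 1) j = f i (j + 1) := by
  intro i
  induction i with
  | zero =>
    intro hi j hj
    have h1 := h 0 (by omega) (j + 1) (by omega)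
    have ha : (a : ℂ) ≠ 0 := by exact_mod_cast (by omega : a ≠ 0)
    have hj0 : (j : ℂ) + 1 ≠ 0 := by exact_mod_cast j.succ_ne_zero
    simp only [Nat.cast_zero, zero_mul, sub_zero, zero_add, Nat.cast_add, Nat.cast_one,
      Nat.add_sub_cancel] at h1
    exact (mul_left_cancel₀ (mul_ne_zero hj0 ha) h1).symm
  | succ i ih =>
    intro hi j hj
    have h1 := h (i + 1) (by omega) (j + 1) (by omega)
    have ha : (a : ℂ) - (i + 1) ≠ 0 := by
      rw [sub_ne_zero]; exact_mod_cast hi.ne'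
    have hj0 : (j : ℂ) + 1 ≠ 0 := by exact_mod_cast j.succ_ne_zero
    -- The equation at `(i + 1, j + 1)` links two successive differences along the line. The earlier
    -- one vanishes by induction, or, at the end `j + 1 = b` of the line, its coefficient does.
    have h2 : ((i : ℂ) + 1) * (b - (j + 1)) * (f (i + 1) (j + 1) - f i (j + 2)) = 0 := by
      rcases Nat.lt_or_ge (j + 1) b with hjb | hjb
      · rw [ih (by omega) (j + 1) hjb, sub_self, mul_zero]
      · have : (b : ℂ) = j + 1 := by exact_mod_cast (by omega : b = j + 1)
        rw [this]; ring
    simp only [Nat.cast_add, Nat.cast_one, Nat.add_sub_cancel] at h1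
    refine (mul_left_cancel₀ (mul_ne_zero hj0 ha) ?_).symm
    linear_combination h1 - h2

/-! ### The Hamiltonian annihilates the valence bond solid -/

section ConfigNorm

variable {V : Type*} {G : SimpleGraph V} [G.LocallyFinite] {S : Finset V}

/-- The norm of the sum of the product states of `⨂ ℂ²` with `k x` ups at each vertex `x`. -/
def configNorm (k : Config G S) : ℂ := ∏ z : S, symNorm (G.degree (z : V)) (k z)

theorem configNorm_ne_zero (k : Config G S) : configNorm k ≠ 0 :=
  Finset.prod_ne_zero_iff.mpr fun z _ => symNorm_ne_zero (Nat.lt_succ_iff.mp (k z).2)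

end ConfigNorm

/-! ### The total spin of two sites -/

section Sites

variable {V : Type*} [DecidableEq V] {G : SimpleGraph V} [G.LocallyFinite] {S : Finset V}

theorem siteOp_mulVec (x : S)
    (M : Matrix (Fin (G.degree (x : V) + 1)) (Fin (G.degree (x : V) + 1)) ℂ)
    (v : Config G S → ℂ) (k : Config G S) :
    (siteOp G x M).mulVec v k = ∑ a, M (k x) a * v (Function.update k x a) := by
  rw [Matrix.mulVec, dotProduct]
  refine (Finset.sum_of_injOn (fun a => Function.update k x a) ?_ ?_ ?_ ?_).symm
  · intro a _ b _ h
    exact Function.update_injective k x h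
  · intro a _; simp
  · intro l _ hl
    rw [siteOp, Matrix.of_apply, if_neg, zero_mul]
    intro h
    refine hl ⟨l x, by simp, funext fun y => ?_⟩
    rcases eq_or_ne y x with rfl | hy
    · simp
    · simp [hy, h y hy]
  · intro a _
    rw [siteOp, Matrix.of_apply, if_pos]
    · simp
    · intro y hy; simp [hy]

theorem ext_mulVec {M N : Observable G S} (h : ∀ v k, M.mulVec v k = N.mulVec v k) : M = N := by
  refine Matrix.ext_iff_mulVec.mpr ?_
  exact fun v => funext (h v)

theorem siteOp_add (x : S)
    (M N : Matrix (Fin (G.degree (x : V) + 1)) (Fin (G.degree (x : V) + 1)) ℂ) :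
    siteOp G x (M + N) = siteOp G x M + siteOp G x N := by
  ext k l
  simp only [siteOp, Matrix.of_apply, Matrix.add_apply]
  split_ifs <;> simp

theorem siteOp_smul (x : S) (c : ℂ)
    (M : Matrix (Fin (G.degree (x : V) + 1)) (Fin (G.degree (x : V) + 1)) ℂ) :
    siteOp G x (c • M) = c • siteOp G x M := by
  ext k l
  simp only [siteOp, Matrix.of_apply, Matrix.smul_apply]
  split_ifs <;> simp

theorem siteOp_mul (x : S)
    (M N : Matrix (Fin (G.degree (x : V) + 1)) (Fin (G.degree (x : V) + 1)) ℂ) :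
    siteOp G x M * siteOp G x N = siteOp G x (M * N) := by
  refine ext_mulVec fun v k => ?_
  rw [← Matrix.mulVec_mulVec, siteOp_mulVec, siteOp_mulVec]
  simp only [siteOp_mulVec, Function.update_self, Function.update_idem, Matrix.mul_apply,
    Finset.mul_sum, Finset.sum_mul]
  rw [Finset.sum_comm]
  simp only [mul_assoc]

theorem siteOp_comm {x y : S} (hxy : x ≠ y)
    (M : Matrix (Fin (G.degree (x : V) + 1)) (Fin (G.degree (x : V) + 1)) ℂ)
    (N : Matrix (Fin (G.degree (y : V) + 1)) (Fin (G.degree (y : V) + 1)) ℂ) :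
    siteOp G x M * siteOp G y N = siteOp G y N * siteOp G x M := by
  refine ext_mulVec fun v k => ?_
  rw [← Matrix.mulVec_mulVec, ← Matrix.mulVec_mulVec, siteOp_mulVec, siteOp_mulVec]
  simp only [siteOp_mulVec, Function.update_of_ne hxy, Function.update_of_ne hxy.symm,
    Finset.mul_sum]
  rw [Finset.sum_comm]
  refine Finset.sum_congr rfl fun a _ => Finset.sum_congr rfl fun b _ => ?_
  rw [Function.update_comm hxy]
  ring

theorem siteOp_diagonal_mulVec (x : S) (g : Fin (G.degree (x : V) + 1) → ℂ) (v : Config G S → ℂ)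
    (k : Config G S) : (siteOp G x (Matrix.diagonal g)).mulVec v k = g (k x) * v k := by
  rw [siteOp_mulVec, Finset.sum_eq_single_of_mem (k x) (Finset.mem_univ _)]
  · rw [Matrix.diagonal_apply_eq, Function.update_eq_self]
  · intro a _ ha
    rw [Matrix.diagonal_apply_ne _ ha.symm, zero_mul]

theorem ladder_identity {R : Type*} [Ring R] [Algebra ℂ R] (P Q : R) :
    ((1 / 2 : ℂ) • (P + Q)) ^ 2 + ((1 / (2 * Complex.I) : ℂ) • (P - Q)) ^ 2 =
      (1 / 2 : ℂ) • (P * Q + Q * P) := by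
  rw [smul_pow, smul_pow]
  have h1 : (1 / 2 : ℂ) ^ 2 = 1 / 4 := by norm_num
  have h2 : (1 / (2 * Complex.I) : ℂ) ^ 2 = -(1 / 4) := by
    rw [div_pow, mul_pow, Complex.I_sq]; norm_num
  have h3 : (1 / 2 : ℂ) = 1 / 4 + 1 / 4 := by norm_num
  rw [h1, h2, h3, add_smul, neg_smul, ← sub_eq_add_neg, ← smul_sub, ← smul_add]
  congr 1
  noncomm_ring

/-- The total spin in terms of ladder operators. -/
theorem totalSpinSq_eq {x y : S} (hxy : x ≠ y) :
    totalSpinSq G x y =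
      siteOp G x (Matrix.diagonal fun _ => (G.degree (x : V) : ℂ) / 2 * (G.degree (x : V) / 2 + 1)) +
      siteOp G y (Matrix.diagonal fun _ => (G.degree (y : V) : ℂ) / 2 * (G.degree (y : V) / 2 + 1)) +
      (siteOp G x (spinPlus _) * siteOp G y (spinMinus _) +
        siteOp G x (spinMinus _) * siteOp G y (spinPlus _)) +
      (2 : ℂ) • (siteOp G x (spinZ _) * siteOp G y (spinZ _)) := by
  have hX : siteOp G x (spinX (G.degree (x : V))) + siteOp G y (spinX (G.degree (y : V))) =
      (1 / 2 : ℂ) • ((siteOp G x (spinPlus _) + siteOp G y (spinPlus _)) +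
        (siteOp G x (spinMinus _) + siteOp G y (spinMinus _))) := by
    rw [spinX, spinX, siteOp_smul, siteOp_smul, siteOp_add, siteOp_add, ← smul_add]
    congr 1
    abel
  have hneg : ∀ (z : S) (M N : Matrix (Fin (G.degree (z : V) + 1)) (Fin (G.degree (z : V) + 1)) ℂ),
      siteOp G z (M - N) = siteOp G z M - siteOp G z N := by
    intro z M N
    rw [sub_eq_add_neg, ← neg_one_smul ℂ N, siteOp_add, siteOp_smul, neg_one_smul,
      ← sub_eq_add_neg]
  have hY : siteOp G x (spinY (G.degree (x : V))) + siteOp G y (spinY (G.degree (y : V))) =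
      (1 / (2 * Complex.I) : ℂ) • ((siteOp G x (spinPlus _) + siteOp G y (spinPlus _)) -
        (siteOp G x (spinMinus _) + siteOp G y (spinMinus _))) := by
    rw [spinY, spinY, siteOp_smul, siteOp_smul, hneg, hneg, ← smul_add]
    congr 1
    abel
  rw [totalSpinSq, hX, hY, ladder_identity, ← spin_casimir, ← spin_casimir, siteOp_add, siteOp_add,
    siteOp_smul, siteOp_smul, siteOp_add, siteOp_add, ← siteOp_mul, ← siteOp_mul, ← siteOp_mul,
    ← siteOp_mul, ← siteOp_mul, ← siteOp_mul]
  have c1 := siteOp_comm hxy (spinPlus (G.degree (x : V))) (spinMinus (G.degree (y : V)))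
  have c2 := siteOp_comm hxy (spinMinus (G.degree (x : V))) (spinPlus (G.degree (y : V)))
  have c3 := siteOp_comm hxy (spinZ (G.degree (x : V))) (spinZ (G.degree (y : V)))
  generalize siteOp G x (spinPlus (G.degree (x : V))) = P at *
  generalize siteOp G y (spinPlus (G.degree (y : V))) = P' at *
  generalize siteOp G x (spinMinus (G.degree (x : V))) = Q at *
  generalize siteOp G y (spinMinus (G.degree (y : V))) = Q' at *
  generalize siteOp G x (spinZ (G.degree (x : V))) = Z at *
  generalize siteOp G y (spinZ (G.degree (y : V))) = Z' at *
  have e1 : (P + P') * (Q + Q') + (Q + Q') * (P + P') =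
      (P * Q + Q * P) + (P' * Q' + Q' * P') + (2 : ℂ) • (P * Q' + Q * P') := by
    rw [two_smul]
    simp only [mul_add, add_mul, ← c1, ← c2]
    abel
  have e2 : (Z + Z') ^ 2 = Z * Z + Z' * Z' + (2 : ℂ) • (Z * Z') := by
    rw [two_smul, pow_two]
    simp only [mul_add, add_mul, ← c3]
    abel
  rw [e1, e2, smul_add, smul_add, smul_smul]
  norm_num
  abel

theorem configNorm_update {x y : S} (hxy : x ≠ y) (k : Config G S)
    (a : Fin (G.degree (x : V) + 1)) (b : Fin (G.degree (y : V) + 1)) :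
    configNorm (Function.update (Function.update k x a) y b) =
      (∏ z ∈ (Finset.univ.erase x).erase y, symNorm (G.degree (z : V)) (k z)) *
        symNorm (G.degree (x : V)) a * symNorm (G.degree (y : V)) b := by
  have hy : y ∈ Finset.univ.erase x := by simp [hxy.symm]
  rw [configNorm, ← Finset.mul_prod_erase _ _ (Finset.mem_univ x),
    ← Finset.mul_prod_erase _ _ hy]
  rw [Function.update_of_ne hxy, Function.update_self, Function.update_self]
  rw [Finset.prod_congr rfl (g := fun z : S => symNorm (G.degree (z : V)) (k z))]
  · ring
  · intro z hz
    simp only [Finset.mem_erase, Finset.mem_univ, and_true] at hz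
    rw [Function.update_of_ne hz.1, Function.update_of_ne hz.2]

/-- In the unnormalised basis, a vector of maximal total spin of `x` and `y` is invariant under
moving one up spin from `x` to `y`. -/
theorem maximal_spin_symmetric {x y : S} (hxy : x ≠ y) {v : Config G S → ℂ}
    (hv : (totalSpinSq G x y).mulVec v =
      (maxSpin G x y * (maxSpin G x y + 1)) • v) (k : Config G S) {i j : ℕ}
    (hi : i < G.degree (x : V)) (hj : j < G.degree (y : V))
    {k₁ k₂ : Config G S}
    (hk₁ : k₁ = Function.update (Function.update k x ⟨i + 1, by omega⟩) y ⟨j, by omega⟩)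
    (hk₂ : k₂ = Function.update (Function.update k x ⟨i, by omega⟩) y ⟨j + 1, by omega⟩) :
    v k₁ / configNorm k₁ = v k₂ / configNorm k₂ := by
  set a := G.degree (x : V) with ha
  set b := G.degree (y : V) with hb
  set R := ∏ z ∈ (Finset.univ.erase x).erase y, symNorm (G.degree (z : V)) (k z) with hR
  have hR0 : R ≠ 0 :=
    Finset.prod_ne_zero_iff.mpr fun z _ => symNorm_ne_zero (Nat.lt_succ_iff.mp (k z).2)
  let K : (i j : ℕ) → i < a + 1 → j < b + 1 → Config G S := fun i j hi hj =>
    Function.update (Function.update k x ⟨i, hi⟩) y ⟨j, hj⟩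
  -- The amplitudes in the unnormalised basis. The default 0 outside the range is met only with
  -- coefficient zero.
  let f : ℕ → ℕ → ℂ := fun i j =>
    if h : i < a + 1 ∧ j < b + 1 then v (K i j h.1 h.2) / configNorm (K i j h.1 h.2) else 0
  have hf : ∀ (i j : ℕ) (hi : i < a + 1) (hj : j < b + 1),
      v (K i j hi hj) = R * (symNorm a i * (symNorm b j * f i j)) := by
    intro i j hi hj
    have h1 : configNorm (K i j hi hj) = R * symNorm a i * symNorm b j :=
      configNorm_update hxy k ⟨i, hi⟩ ⟨j, hj⟩
    simp only [f, dif_pos (And.intro hi hj)]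
    rw [← mul_assoc, ← mul_assoc, ← h1, mul_div_cancel₀ _ (configNorm_ne_zero _)]
  have hline := eq_of_line_equation (a := a) (b := b) (f := f) (fun i hi j hj => by
    have hi' : i < a + 1 := by omega
    have hj' : j < b + 1 := by omega
    set k' := K i j hi' hj' with hk'
    have hkx : k' x = ⟨i, hi'⟩ := by
      simp only [hk', K, Function.update_of_ne hxy, Function.update_self]
    have hky : k' y = ⟨j, hj'⟩ := by
      simp only [hk', K, Function.update_self]
    have hupd : ∀ (m : Fin (a + 1)) (n : Fin (b + 1)),
        Function.update (Function.update k' x m) y n = K m n m.2 n.2 := by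
      intro m n
      simp only [hk', K]
      rw [Function.update_comm hxy.symm, Function.update_idem, Function.update_idem]
    have hpair : ∀ (M : Matrix (Fin (a + 1)) (Fin (a + 1)) ℂ)
        (N : Matrix (Fin (b + 1)) (Fin (b + 1)) ℂ),
        (siteOp G x M * siteOp G y N).mulVec v k' = R * ∑ m : Fin (a + 1),
          M ⟨i, hi'⟩ m * (symNorm a m * ∑ n : Fin (b + 1),
            N ⟨j, hj'⟩ n * (symNorm b n * f m n)) := by
      intro M N
      rw [← Matrix.mulVec_mulVec, siteOp_mulVec, hkx, Finset.mul_sum]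
      refine Finset.sum_congr rfl fun m _ => ?_
      rw [siteOp_mulVec, Function.update_of_ne hxy.symm, hky, Finset.mul_sum, Finset.mul_sum,
        Finset.mul_sum, Finset.mul_sum]
      refine Finset.sum_congr rfl fun n _ => ?_
      rw [hupd, hf]
      ring
    have h1 := congrFun hv k'
    rw [totalSpinSq_eq hxy, Matrix.add_mulVec, Matrix.add_mulVec, Matrix.add_mulVec,
      Matrix.add_mulVec, Matrix.smul_mulVec] at h1
    simp only [Pi.add_apply, Pi.smul_apply, smul_eq_mul] at h1
    have s1 : ∀ m : Fin (a + 1), ∑ n : Fin (b + 1),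
        spinMinus b ⟨j, hj'⟩ n * (symNorm b n * f m n) = (b - j) * symNorm b j * f m (j + 1) :=
      fun m => sum_spinMinus b ⟨j, hj'⟩ fun n => f m n
    have s2 : ∀ m : Fin (a + 1), ∑ n : Fin (b + 1),
        spinPlus b ⟨j, hj'⟩ n * (symNorm b n * f m n) = j * symNorm b j * f m (j - 1) :=
      fun m => sum_spinPlus b ⟨j, hj'⟩ fun n => f m n
    have p1 : (siteOp G x (spinPlus _) * siteOp G y (spinMinus _)).mulVec v k' =
        R * (i * symNorm a i * ((b - j) * symNorm b j * f (i - 1) (j + 1))) := by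
      refine (hpair (spinPlus a) (spinMinus b)).trans ?_
      simp only [s1]
      rw [sum_spinPlus a ⟨i, hi'⟩ fun m => (b - j) * symNorm b j * f m (j + 1)]
    have p2 : (siteOp G x (spinMinus _) * siteOp G y (spinPlus _)).mulVec v k' =
        R * ((a - i) * symNorm a i * (j * symNorm b j * f (i + 1) (j - 1))) := by
      refine (hpair (spinMinus a) (spinPlus b)).trans ?_
      simp only [s2]
      rw [sum_spinMinus a ⟨i, hi'⟩ fun m => j * symNorm b j * f m (j - 1)]
    rw [p1, p2, siteOp_diagonal_mulVec, siteOp_diagonal_mulVec, ← Matrix.mulVec_mulVec,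
      spinZ, spinZ, siteOp_diagonal_mulVec, siteOp_diagonal_mulVec, hkx, hky, hk',
      hf i j hi' hj', maxSpin] at h1
    have hne : R * symNorm a i * symNorm b j ≠ 0 :=
      mul_ne_zero (mul_ne_zero hR0 (symNorm_ne_zero hi)) (symNorm_ne_zero hj)
    -- The two Casimir terms plus twice the `S^z` product, minus `J (J + 1)`, equal `-(i (b - j) + j
    -- (a - i))`, so the eigenvalue equation is the line equation.
    refine mul_left_cancel₀ hne ?_
    simp only [← ha, ← hb] at h1
    linear_combination -h1)
  have h2 := hline i hi j hj
  subst hk₁ hk₂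
  simpa only [f, dif_pos (And.intro (show i + 1 < a + 1 by omega) (show j < b + 1 by omega)),
    dif_pos (And.intro (show i < a + 1 by omega) (show j + 1 < b + 1 by omega))] using h2

end Sites

/-! ### Exchanging the two spins 1/2 of an edge -/

section Swap

variable {V : Type*} [DecidableEq V] {G : SimpleGraph V} {T : Finset V}

/-- Exchange the two spins 1/2 on the edge between `x` and `y`. -/
def swapLegs (x y : T) (h : G.Adj (x : V) (y : V)) (s : Legs G T) : Legs G T :=
  Function.update (Function.update s x (Function.update (s x) ⟨y, h⟩ (s y ⟨x, h.symm⟩))) y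
    (Function.update (s y) ⟨x, h.symm⟩ (s x ⟨y, h⟩))

variable {x y : T} (h : G.Adj (x : V) (y : V)) (s : Legs G T)

theorem swapLegs_fst : swapLegs x y h s x = Function.update (s x) ⟨y, h⟩ (s y ⟨x, h.symm⟩) := by
  have hxy : x ≠ y := fun e => h.ne (congrArg Subtype.val e)
  rw [swapLegs, Function.update_of_ne hxy, Function.update_self]

theorem swapLegs_snd : swapLegs x y h s y = Function.update (s y) ⟨x, h.symm⟩ (s x ⟨y, h⟩) := by
  rw [swapLegs, Function.update_self]

theorem swapLegs_of_ne {z : T} (hx : z ≠ x) (hy : z ≠ y) : swapLegs x y h s z = s z := by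
  rw [swapLegs, Function.update_of_ne hy, Function.update_of_ne hx]

theorem swapLegs_swapLegs : swapLegs x y h (swapLegs x y h s) = s := by
  funext z
  rcases eq_or_ne z x with rfl | hx
  · rw [swapLegs_fst, swapLegs_fst, swapLegs_snd, Function.update_self, Function.update_idem,
      Function.update_eq_self]
  · rcases eq_or_ne z y with rfl | hy
    · rw [swapLegs_snd, swapLegs_snd, swapLegs_fst, Function.update_self, Function.update_idem,
        Function.update_eq_self]
    · rw [swapLegs_of_ne _ _ hx hy, swapLegs_of_ne _ _ hx hy]

theorem leg_swapLegs_fst : leg (swapLegs x y h s) x y = leg s y x := by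
  rw [leg_of_mem _ x.2 h, leg_of_mem _ y.2 h.symm, swapLegs_fst, Function.update_self]

theorem leg_swapLegs_snd : leg (swapLegs x y h s) y x = leg s x y := by
  rw [leg_of_mem _ x.2 h, leg_of_mem _ y.2 h.symm, swapLegs_snd, Function.update_self]

theorem leg_swapLegs_of_ne {a b : V} (h1 : a ≠ x ∨ b ≠ y) (h2 : a ≠ y ∨ b ≠ x) :
    leg (swapLegs x y h s) a b = leg s a b := by
  by_cases hab : a ∈ T ∧ G.Adj a b
  · obtain ⟨ha, hadj⟩ := hab
    rw [leg_of_mem _ ha hadj, leg_of_mem _ ha hadj]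
    by_cases hax : a = x
    · subst hax
      have hb : b ≠ y := h1.resolve_left (by simp)
      have := congrFun (swapLegs_fst h s) ⟨b, hadj⟩
      rw [Function.update_of_ne fun e => hb (congrArg Subtype.val e)] at this
      exact this
    · by_cases hay : a = y
      · subst hay
        have hb : b ≠ x := h2.resolve_left (by simp)
        have := congrFun (swapLegs_snd h s) ⟨b, hadj⟩
        rw [Function.update_of_ne fun e => hb (congrArg Subtype.val e)] at this
        exact this
      · rw [swapLegs_of_ne h s (z := ⟨a, ha⟩) (fun e => hax (congrArg Subtype.val e))
          (fun e => hay (congrArg Subtype.val e))]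
  · rw [leg, dif_neg hab, leg, dif_neg hab]

end Swap

/-! ### Orthogonality of the singlets to maximal total spin -/

section Ground

variable {V : Type*} {G : SimpleGraph V} [G.LocallyFinite] {T : Finset V}

/-- The number of up spins at each vertex. -/
def upCount (s : Legs G T) : Config G T := fun z =>
  ⟨(Finset.univ.filter fun i => s z i = true).card, Nat.lt_succ_of_le <| by
    rw [← G.card_neighborSet_eq_degree]; exact Finset.card_le_univ _⟩

theorem prod_symAmplitude (k : Config G T) (s : Legs G T) :
    ∏ z : T, symAmplitude (k z : ℕ) (s z) = if k = upCount s then 1 / configNorm k else 0 := by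
  by_cases h : k = upCount s
  · subst h
    rw [if_pos rfl, configNorm, one_div, ← Finset.prod_inv_distrib]
    refine Finset.prod_congr rfl fun z _ => ?_
    have hc : (Finset.univ.filter fun i => s z i = true).card = (upCount s z : ℕ) := rfl
    rw [symAmplitude, if_pos hc, symNorm, G.card_neighborSet_eq_degree]
    push_cast
    rw [one_div]
  · rw [if_neg h]
    obtain ⟨z, hz⟩ := Function.ne_iff.mp h
    refine Finset.prod_eq_zero (Finset.mem_univ z) ?_
    rw [symAmplitude, if_neg]
    intro h'
    exact hz (Fin.ext h'.symm)

variable [DecidableEq V] {x y : T} (h : G.Adj (x : V) (y : V)) (s : Legs G T)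

theorem singlet_swap (a b : Bool) : singlet b a = -singlet a b := by
  cases a <;> cases b <;> simp [singlet]

/-- The amplitude of a vector of maximal total spin is invariant under the exchange. -/
theorem apply_upCount_swapLegs {v : Config G T → ℂ}
    (hv : (totalSpinSq G x y).mulVec v = (maxSpin G x y * (maxSpin G x y + 1)) • v) :
    v (upCount (swapLegs x y h s)) / configNorm (upCount (swapLegs x y h s)) =
      v (upCount s) / configNorm (upCount s) := by
  have hxy : x ≠ y := fun e => h.ne (congrArg Subtype.val e)
  -- The exchange moves one up spin from `x` to `y`. The opposite case is this one for the exchanged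
  -- legs, and equal spins are left unchanged.
  have key : ∀ t : Legs G T, t x ⟨y, h⟩ = true → t y ⟨x, h.symm⟩ = false →
      v (upCount t) / configNorm (upCount t) =
        v (upCount (swapLegs x y h t)) / configNorm (upCount (swapLegs x y h t)) := by
    intro t hx hy
    set i := (Finset.univ.filter fun j : {j // j ≠ (⟨y, h⟩ : G.neighborSet (x : V))} =>
      t x j = true).card with hi
    set j := (Finset.univ.filter fun j : {j // j ≠ (⟨x, h.symm⟩ : G.neighborSet (y : V))} =>
      t y j = true).card with hj
    have hcx := card_filter_eq_ite_add (t x) ⟨y, h⟩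
    have hcy := card_filter_eq_ite_add (t y) ⟨x, h.symm⟩
    have hsx := card_filter_eq_ite_add (swapLegs x y h t x) ⟨y, h⟩
    have hsy := card_filter_eq_ite_add (swapLegs x y h t y) ⟨x, h.symm⟩
    have ex : (Finset.univ.filter fun j : {j // j ≠ (⟨y, h⟩ : G.neighborSet (x : V))} =>
        swapLegs x y h t x j = true).card = i := by
      rw [swapLegs_fst, hi]
      congr 1
      ext j
      simp [Function.update_of_ne j.2]
    have ey : (Finset.univ.filter fun j : {j // j ≠ (⟨x, h.symm⟩ : G.neighborSet (y : V))} =>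
        swapLegs x y h t y j = true).card = j := by
      rw [swapLegs_snd, hj]
      congr 1
      ext j
      simp [Function.update_of_ne j.2]
    have vx : swapLegs x y h t x ⟨y, h⟩ = false := by rw [swapLegs_fst, Function.update_self, hy]
    have vy : swapLegs x y h t y ⟨x, h.symm⟩ = true := by
      rw [swapLegs_snd, Function.update_self, hx]
    rw [ex, vx] at hsx
    rw [ey, vy] at hsy
    rw [← hi, hx] at hcx
    rw [← hj, hy] at hcy
    simp only [if_true, Bool.false_eq_true, if_false, zero_add] at hcx hcy hsx hsy
    have bx := (upCount t x).2
    have hby := (upCount (swapLegs x y h t) y).2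
    simp only [upCount, hcx, hsy] at bx hby
    refine maximal_spin_symmetric hxy hv (upCount t) (i := i) (j := j) (by omega) (by omega)
      ?_ ?_
    · funext z
      rcases eq_or_ne z y with rfl | hzy
      · rw [Function.update_self]
        exact Fin.ext hcy
      · rw [Function.update_of_ne hzy]
        rcases eq_or_ne z x with rfl | hzx
        · rw [Function.update_self]
          exact Fin.ext (hcx.trans (add_comm _ _))
        · rw [Function.update_of_ne hzx]
    · funext z
      rcases eq_or_ne z y with rfl | hzy
      · rw [Function.update_self]
        exact Fin.ext (hsy.trans (add_comm _ _))
      · rw [Function.update_of_ne hzy]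
        rcases eq_or_ne z x with rfl | hzx
        · rw [Function.update_self]
          exact Fin.ext hsx
        · rw [Function.update_of_ne hzx]
          simp only [upCount, swapLegs_of_ne h t hzx hzy]
  cases hx : s x ⟨y, h⟩ <;> cases hy : s y ⟨x, h.symm⟩
  · have : swapLegs x y h s = s := by
      rw [swapLegs, hy, ← hx, Function.update_eq_self, Function.update_eq_self, hx, ← hy,
        Function.update_eq_self, Function.update_eq_self]
    rw [this]
  · rw [key (swapLegs x y h s) (by rw [swapLegs_fst, Function.update_self, hy])
      (by rw [swapLegs_snd, Function.update_self, hx]), swapLegs_swapLegs]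
  · exact (key s hx hy).symm
  · have : swapLegs x y h s = s := by
      rw [swapLegs, hy, ← hx, Function.update_eq_self, Function.update_eq_self, hx, ← hy,
        Function.update_eq_self, Function.update_eq_self]
    rw [this]

variable {o : V}

/-- Reindex the leg states by the exchange on the edge `xy`: the amplitude of `v` is invariant, the
singlet on `xy` changes sign, and no other factor is affected. The sum equals its own negative. -/
theorem sum_mul_vbs_eq_zero (hG : G.IsTree) {n : ℕ} {x y : ball G o n}
    (hc : IsChild G o (x : V) (y : V)) {v : Config G (ball G o n) → ℂ}
    (hv : (totalSpinSq G x y).mulVec v = (maxSpin G x y * (maxSpin G x y + 1)) • v)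
    (b : BoundaryConfig G o n) : ∑ k, v k * vbs G o n k b = 0 := by
  classical
  simp only [vbs_apply hG, Finset.mul_sum]
  rw [Finset.sum_comm]
  set E : Legs G (ball G o n) → ℂ := fun s =>
    ∏ x ∈ ball G o n, ∏ y ∈ children G o x,
      if y ∈ ball G o n then singlet (leg s x y) (leg s y x) else 1 with hE
  set D : Legs G (ball G o n) → ℂ := fun s =>
    ∏ v : boundary G o n, ∏ x ∈ ball G o n,
      if IsChild G o x v then (if leg s x v = b v then 1 else 0) else 1 with hD
  have h1 : ∀ s : Legs G (ball G o n), ∑ k, v k *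
      ((∏ x : ball G o n, symAmplitude (k x : ℕ) (s x)) * E s * D s) =
      v (upCount s) / configNorm (upCount s) * (E s * D s) := by
    intro s
    rw [Finset.sum_eq_single_of_mem (upCount s) (Finset.mem_univ _)]
    · rw [prod_symAmplitude, if_pos rfl]
      ring
    · intro k _ hk
      rw [prod_symAmplitude, if_neg hk]
      ring
  rw [Finset.sum_congr rfl fun s _ => h1 s]
  have hEs : ∀ s, E (swapLegs x y hc.1 s) = -E s := by
    intro s
    simp only [hE]
    rw [prod_children_eq hG x.2 hc, prod_children_eq hG x.2 hc, if_pos y.2, if_pos y.2,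
      leg_swapLegs_fst, leg_swapLegs_snd, singlet_swap, neg_mul]
    congr 2
    refine Finset.prod_congr rfl fun x' hx' => Finset.prod_congr rfl fun y' hy' => ?_
    obtain ⟨hy1, hy2⟩ := Finset.mem_erase.mp hy'
    have hc' := mem_children.mp hy2
    -- The reversed pair `(y, x)` is not a parent and its child, so the remaining edge factors do
    -- not see the exchange.
    have hne : x' ≠ y ∨ y' ≠ x := by
      by_contra! hcon
      have e1 := hc'.2
      have e2 := hc.2
      rw [hcon.1, hcon.2] at e1
      omega
    rw [leg_swapLegs_of_ne _ _ (Or.inr hy1) hne, leg_swapLegs_of_ne _ _ hne.symm (Or.inl hy1)]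
  have hDs : ∀ s, D (swapLegs x y hc.1 s) = D s := by
    intro s
    simp only [hD]
    refine Finset.prod_congr rfl fun w _ => Finset.prod_congr rfl fun x' _ => ?_
    have hw : (w : V) ∉ ball G o n := (Finset.mem_sdiff.mp w.2).2
    rw [leg_swapLegs_of_ne _ _ (Or.inr fun e => hw (by rw [e]; exact y.2))
      (Or.inr fun e => hw (by rw [e]; exact x.2))]
  have h2 : ∑ s, v (upCount s) / configNorm (upCount s) * (E s * D s) =
      -∑ s, v (upCount s) / configNorm (upCount s) * (E s * D s) := by
    have hinv : Function.Involutive (swapLegs x y hc.1) := swapLegs_swapLegs hc.1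
    rw [← Finset.sum_neg_distrib]
    refine (Equiv.sum_comp (hinv.toPerm _) _).symm.trans ?_
    refine Finset.sum_congr rfl fun s _ => ?_
    rw [Function.Involutive.coe_toPerm, apply_upCount_swapLegs hc.1 s hv, hEs, hDs]
    ring
  exact self_eq_neg.mp h2

theorem edgeProjection_vbs_mulVec (hG : G.IsTree) {n : ℕ} {x y : ball G o n}
    (hc : IsChild G o (x : V) (y : V)) (u : BoundaryConfig G o n → ℂ) :
    edgeProjection G x y (WithLp.toLp 2 ((vbs G o n).mulVec u)) = 0 := by
  rw [edgeProjection, ContinuousLinearMap.coe_coe, Submodule.starProjection_apply_eq_zero_iff,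
    Submodule.mem_orthogonal]
  intro v hv
  have hv' : (totalSpinSq G x y).mulVec v.ofLp =
      (maxSpin G x y * (maxSpin G x y + 1)) • v.ofLp := by
    have := congrArg WithLp.ofLp (Module.End.mem_eigenspace_iff.mp hv)
    rwa [Matrix.ofLp_toLpLin, Matrix.toLin'_apply, WithLp.ofLp_smul] at this
  -- The inner product conjugates `v`; as the valence bond solid map is real, conjugating the
  -- bilinear identity suffices.
  have key : ∀ b, ∑ k, star (v.ofLp k) * vbs G o n k b = 0 := by
    intro b
    have := congrArg star (sum_mul_vbs_eq_zero hG hc hv' b)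
    rw [star_sum, star_zero] at this
    rw [← this]
    refine Finset.sum_congr rfl fun k _ => ?_
    rw [star_mul', star_vbs hG]
  rw [EuclideanSpace.inner_eq_star_dotProduct, dotProduct_comm, Matrix.dotProduct_mulVec]
  have : Matrix.vecMul (star v.ofLp) (vbs G o n) = 0 := by
    funext b
    exact key b
  rw [this, zero_dotProduct]

/-- Every boundary condition defines a ground state. -/
theorem hamiltonian_density_eq_zero (hG : G.IsTree) (n : ℕ) (B : BoundaryMatrix G o n) :
    hamiltonian G o n ∘ₗ Matrix.toEuclideanLin (density G o n B) = 0 := by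
  refine LinearMap.ext fun z => ?_
  rw [LinearMap.comp_apply, LinearMap.zero_apply, Matrix.toLpLin_apply, density,
    Matrix.mul_assoc, ← Matrix.mulVec_mulVec, hamiltonian, LinearMap.sum_apply]
  refine Finset.sum_eq_zero fun x _ => ?_
  rw [LinearMap.sum_apply]
  refine Finset.sum_eq_zero fun y _ => ?_
  split_ifs with hc
  · exact edgeProjection_vbs_mulVec hG hc _
  · rfl

end Ground

/-! ### The two ground states -/

section Final

variable {V : Type*} [DecidableEq V] {G : SimpleGraph V} [G.LocallyFinite] {o : V}

theorem isGroundBoundary_productBoundary (hG : G.IsTree) {d : ℕ → ℕ}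
    (hd : ∀ x : V, G.degree x = d (G.dist o x)) {θ : ℕ → ℝ} (hθ : IsConsistent d θ) (n : ℕ) :
    IsGroundBoundary G o n (productBoundary G o θ n) :=
  ⟨posSemidef_productBoundary θ n, trace_density_ne_zero hG hd hθ n,
    hamiltonian_density_eq_zero hG n _⟩

theorem expectation_eq_of_le (hG : G.IsTree) {d : ℕ → ℕ}
    (hd : ∀ x : V, G.degree x = d (G.dist o x)) {θ : ℕ → ℝ} (hθ : IsConsistent d θ) {m n : ℕ}
    (hmn : m ≤ n) {S : Finset V} (h : S ⊆ ball G o m) (A : Observable G S) :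
    expectation G o n (productBoundary G o θ n) S A =
      expectation G o m (productBoundary G o θ m) S A := by
  induction n, hmn using Nat.le_induction with
  | base => rfl
  | succ n hmn ih =>
    rw [expectation_succ hG hd hθ (h.trans (ball_mono hG.connected hmn)), ih]

theorem exists_subset_ball (hG : G.Connected) (S : Finset V) : ∃ m, S ⊆ ball G o m :=
  ⟨S.sup (G.dist o), fun x hx => (mem_ball G o hG _ x).mpr (Finset.le_sup (f := G.dist o) hx)⟩

/-- Consistent fields define an infinite-volume ground state, whose restriction to each ball is a
finite-volume ground state. -/
theorem exists_isInfiniteVolumeGroundState (hG : G.IsTree) {d : ℕ → ℕ}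
    (hd : ∀ x : V, G.degree x = d (G.dist o x)) {θ : ℕ → ℝ} (hθ : IsConsistent d θ) :
    ∃ ω : (S : Finset V) → Observable G S → ℂ, IsInfiniteVolumeGroundState G o ω ∧
      ∀ (n : ℕ) (A : Observable G (ball G o n)),
        ω (ball G o n) A = expectation G o n (productBoundary G o θ n) (ball G o n) A := by
  choose m hm using fun S : Finset V => exists_subset_ball (o := o) hG.connected S
  refine ⟨fun S A => expectation G o (m S) (productBoundary G o θ (m S)) S A,
    ⟨productBoundary G o θ, isGroundBoundary_productBoundary hG hd hθ, fun S A => ?_⟩,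
    fun n A => ?_⟩
  -- Once the ball contains `S`, the expectation no longer depends on `n`.
  · refine tendsto_const_nhds.congr' ?_
    filter_upwards [eventually_ge_atTop (m S)] with n hn
    exact (expectation_eq_of_le hG hd hθ hn (hm S) A).symm
  · rcases le_total (m (ball G o n)) n with h | h
    · exact (expectation_eq_of_le hG hd hθ h (hm _) A).symm
    · exact expectation_eq_of_le hG hd hθ h (Finset.Subset.refl _) A

/-- The projection onto the state of the root with all spins 1/2 up. -/
def rootUp : Observable G (ball G o 0) :=
  Matrix.diagonal fun k =>
    if (k ⟨o, root_mem_ball_zero⟩ : ℕ) = G.degree o then 1 else 0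

theorem IsConsistent.neg {d : ℕ → ℕ} {θ : ℕ → ℝ} (hθ : IsConsistent d θ) :
    IsConsistent d (-θ) := by
  intro i
  rw [Pi.neg_apply, Pi.neg_apply, branchField_neg, hθ i]

theorem expectation_rootUp (hG : G.IsTree) (θ : ℕ → ℝ) :
    expectation G o 0 (productBoundary G o θ 0) (ball G o 0) (rootUp : Observable G (ball G o 0)) =
      ((Real.exp (G.degree o * θ 1) / partitionSum (G.degree o) (θ 1) : ℝ) : ℂ) := by
  let _ : Unique (ball G o 0) :=
    ⟨⟨⟨o, root_mem_ball_zero⟩⟩, fun x => Subtype.ext (Finset.mem_singleton.mp x.2)⟩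
  have hsum : ∀ φ : ℕ → ℂ, ∑ k : Config G (ball G o 0), φ (k ⟨o, root_mem_ball_zero⟩ : ℕ) =
      ∑ j ∈ Finset.range (G.degree o + 1), φ j := by
    intro φ
    rw [← Fin.sum_univ_eq_sum_range]
    exact Fintype.sum_equiv
      (Equiv.piUnique fun x : ball G o 0 => Fin (G.degree (x : V) + 1)) _
      (fun j : Fin (G.degree o + 1) => φ j) fun k => rfl
  rw [expectation, dif_pos (Finset.Subset.refl _), extend_self, density_productBoundary hG]
  simp only [Matrix.trace, Matrix.diag_apply, rootUp, Matrix.mul_diagonal, netState_root_diag]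
  rw [hsum fun j => ((Real.exp ((2 * j - G.degree o) * θ 1) : ℝ) : ℂ) *
      (if j = G.degree o then 1 else 0),
    hsum fun j => ((Real.exp ((2 * j - G.degree o) * θ 1) : ℝ) : ℂ)]
  simp only [mul_ite, mul_one, mul_zero]
  rw [Finset.sum_ite_eq' (Finset.range (G.degree o + 1)) (G.degree o), if_pos (by simp),
    partitionSum]
  push_cast
  congr 2
  ring

theorem partitionSum_neg (q : ℕ) (θ : ℝ) : partitionSum q (-θ) = partitionSum q θ := by
  rw [partitionSum, partitionSum, sum_range_flip_exp q fun u => Real.exp (u * θ)]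
  simp only [mul_neg, neg_mul]

/-- The fields `θ` and `-θ` give states with the same partition sum at the root but all-up weights
`e^{dθ_1}` and `e^{-dθ_1}`, where `d > 0` is the degree of the root. -/
theorem exists_ne_isInfiniteVolumeGroundState (hG : G.IsTree) {d : ℕ → ℕ}
    (hd : ∀ x : V, G.degree x = d (G.dist o x)) (ho : 0 < G.degree o) {θ : ℕ → ℝ}
    (hθ : IsConsistent d θ) (hθ1 : θ 1 ≠ 0) :
    ∃ ω₁ ω₂ : (S : Finset V) → Observable G S → ℂ,
      IsInfiniteVolumeGroundState G o ω₁ ∧ IsInfiniteVolumeGroundState G o ω₂ ∧ ω₁ ≠ ω₂ := by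
  obtain ⟨ω₁, h₁, e₁⟩ := exists_isInfiniteVolumeGroundState hG hd hθ
  obtain ⟨ω₂, h₂, e₂⟩ := exists_isInfiniteVolumeGroundState hG hd hθ.neg
  refine ⟨ω₁, ω₂, h₁, h₂, ?_⟩
  rintro rfl
  have h := (e₁ 0 rootUp).symm.trans (e₂ 0 rootUp)
  rw [expectation_rootUp hG, expectation_rootUp hG, Complex.ofReal_inj, Pi.neg_apply,
    partitionSum_neg, div_left_inj' (partitionSum_pos _ _).ne', Real.exp_eq_exp] at h
  have hdeg : (0 : ℝ) < G.degree o := by exact_mod_cast ho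
  have h' := mul_left_cancel₀ hdeg.ne' h
  exact hθ1 (by linarith)

end Final

end AKLT

end

theorem mainTheorem4 {V : Type*} [DecidableEq V] [Infinite V]
    (G : SimpleGraph V) [G.LocallyFinite] (hG : G.IsTree) (o : V) (d : ℕ → ℕ)
    (hd : ∀ x : V, G.degree x = d (G.dist o x))
    (L : EReal) (hL : 0 < L)
    (hlim : Tendsto
      (fun n : ℕ =>
        (((1 / (n : ℝ)) * ∑ i ∈ Finset.Icc 1 n, Real.log (((d i : ℝ) - 1) / 3) : ℝ) : EReal))
      atTop (𝓝 L)) :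
    ∃ ω₁ ω₂ : (S : Finset V) → AKLT.Observable G S → ℂ,
      AKLT.IsInfiniteVolumeGroundState G o ω₁ ∧
      AKLT.IsInfiniteVolumeGroundState G o ω₂ ∧ ω₁ ≠ ω₂ := by
  have hd2 : ∀ i, 2 ≤ d (i + 1) := by
    intro i
    obtain ⟨x, hx, hdeg⟩ := AKLT.exists_dist_eq_two_le_degree hG.connected o i
    rwa [hd, hx] at hdeg
  have ho : 0 < G.degree o := by
    obtain ⟨x, hx, hdeg⟩ := AKLT.exists_dist_eq_degree_pos hG.connected o 0
    rw [hd, hx] at hdeg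
    rwa [hd, SimpleGraph.dist_self]
  obtain ⟨τ, hτ0, hτ⟩ := AKLT.exists_branchField_orbit_of_tendsto (fun i => d (i + 1) - 1)
    (fun i => by have := hd2 i; omega) L hL <| by
      -- Layers `1, …, n` become the indices `0, …, n - 1` of `q i = d (i + 1) - 1`; the degree of
      -- the root does not enter.
      refine hlim.congr fun n => ?_
      rw [Finset.range_eq_Ico, Finset.sum_Ico_add' (fun i => Real.log (((d i - 1 : ℕ) : ℝ) / 3))]
      rw [zero_add, ← Finset.Ico_add_one_right_eq_Icc]
      congr 2
      refine Finset.sum_congr rfl fun i hi => ?_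
      have h1 := (Finset.mem_Ico.mp hi).1
      have h2 := hd2 (i - 1)
      rw [Nat.sub_add_cancel h1] at h2
      rw [Nat.cast_sub (by omega), Nat.cast_one]
  -- The alternating sign absorbs the minus sign of the singlets, and the shift gives `θ 1 = -τ 0`.
  -- The value `θ 0` plays no role, as no leg ends at the root from above.
  refine AKLT.exists_ne_isInfiniteVolumeGroundState hG hd ho
    (θ := fun i => (-1) ^ i * τ (i - 1)) (fun i => ?_) (by simpa using hτ0.ne')
  have hsign : ∀ (m : ℕ) (q : ℕ) (t : ℝ),
      AKLT.branchField q ((-1) ^ m * t) = (-1) ^ m * AKLT.branchField q t := by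
    intro m q t
    rcases neg_one_pow_eq_or ℝ m with h | h
    · rw [h, one_mul, one_mul]
    · rw [h, neg_one_mul, neg_one_mul, AKLT.branchField_neg]
  simp only [hsign, Nat.add_sub_cancel]
  have : i + 2 - 1 = i + 1 := by omega
  rw [this, ← hτ i]
  ring
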